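/- Let $d,n\ge 1$. A labelled loopless generalized chord diagram is a partition of $dn$ points, placed on a circle and labelled in circular order, into $n$ blocks of size $d$ (subgraphs $K_d$) such that any two distinct neighbouring points lie in different blocks. The dihedral group $D_{dn}$ of order $2dn$ (rotations and reflections) acts on these diagrams; let $\tilde b_n$ be the number of its orbits. For $m\mid dn$ let $f(dn,m)$ be the number of diagrams fixed by a rotation of order $m$ (it is the same for all such rotations), and for $i=0,1,2$ let $h^{(i)}(n)$ be the number of diagrams symmetric under the reflection about an axis passing through exactly $i$ of the points (it is the same for all such axes, and is $0$ if there is no such axis). Then $$\tilde b_n=\frac{1}{2dn}\sum_{m\mid dn}\varphi(m)\,f(dn,m)+\frac{h^{(0)}(n)+2h^{(1)}(n)+h^{(2)}(n)}{4}.$$ Let $a_{v,k}^{(2,d)}$ be the number of $2$-linear diagrams with $v$ points and $k$ loops in each sector: partitions into blocks of size $d$ of $2v$ points arranged in two linearly ordered sectors of $v$ points, invariant under the exchange of the two sectors, such that in each sector exactly $k$ of the pairs of consecutive points lie in a common block ($a^{(2,d)}_{0,0}=1$). Let $\binom{x}{y}=0$ unless $0\le y\le x$. If $dn$ is odd then $h^{(0)}(n)=h^{(2)}(n)=0$;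 if $dn$ is even then $h^{(1)}(n)=0$. In the other cases, for $n\ge2$: * if $d$ is even, $$h^{(0)}(n)=a_{dn/2,0}^{(2,d)}-2\sum_{k=0}^{d/2-1}\alpha^{(1)}_k a_{d(n-1)/2,k}^{(2,d)}+\sum_{k=0}^{d-2}\alpha^{(2)}_k a_{d(n-2)/2,k}^{(2,d)}-\sum_{k=0}^{d/2-2}\alpha^{(3)}_k a_{d(n-1)/2,k}^{(2,d)},$$ $$h^{(2)}(n)=\sum_{k=0}^{d/2-1}\alpha^{(1)}_k a_{d(n-1)/2,k}^{(2,d)},$$ where $$\alpha^{(1)}_k=\binom{(n-1)d/2-1-k}{d/2-1-k},\qquad \alpha^{(3)}_k=\binom{(n-1)d/2-1-k}{d/2-2-k},$$ $$\alpha^{(2)}_k=\sum_{j=0}^{d/2-1}\ \sum_{s=0}^{\min(k,\,d/2-1-j)}\binom{d/2-1}{j}\binom{k}{s}\binom{(n-2)d/2-k}{d/2-1-j-s}\binom{(n-1)d/2-1-(k+j-s)}{d/2-1-(k+j-s)};$$ * if $d$ is odd and $n$ is even, $h^{(0)}(n)=a_{dn/2,0}^{(2,d)}$ and $$h^{(2)}(n)=\sum_{k=0}^{d-1}\sum_{j=0}^{(d-1)/2}\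 \sum_{s=0}^{\min(k,(d-1)/2-j)}\binom{(d-1)/2}{j}\binom{k}{s}\binom{d(n-2)/2-k}{(d-1)/2-j-s}\binom{(d(n-1)-1)/2-(k+j-s)}{(d-1)/2-(k+j-s)}\,a_{d(n-2)/2,k}^{(2,d)};$$ * if $d$ and $n$ are odd, $$h^{(1)}(n)=\sum_{k=0}^{(d-1)/2}\binom{d(n-1)/2-1-k}{(d-1)/2-k}\,a_{d(n-1)/2,k}^{(2,d)}.$$ Moreover, if $dn\ge3$, then $\tilde b_n$ is the number of undirected unlabelled Hamiltonian cycles in the complete $n$-partite graph $K_{d,\dots,d}$ with $d$ vertices in each part, i.e. of Hamiltonian cycles (as sets of edges) up to automorphisms of the graph. -/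

import Mathlib

namespace KChord

/-- The group `D_N` of rotations `x ↦ x + i` and reflections `x ↦ -i - x` of `N` points, labelled
by `ZMod N` in circular order. -/
def dihedralPerm (N : ℕ) : DihedralGroup N →* Equiv.Perm (ZMod N) where
  toFun g := match g with
    | DihedralGroup.r i => Equiv.addRight i
    | DihedralGroup.sr i => Equiv.subLeft (-i)
  map_one' := by
    refine Equiv.ext fun x => ?_
    exact add_zero x
  map_mul' := by
    rintro (i | i) (j | j)
    all_goals
      refine Equiv.ext fun x => ?_
      simp only [DihedralGroup.r_mul_r, DihedralGroup.r_mul_sr, DihedralGroup.sr_mul_r,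
        DihedralGroup.sr_mul_sr, Equiv.Perm.coe_mul, Function.comp_apply,
        Equiv.coe_addRight, Equiv.subLeft_apply]
      ring

/-- A partition of `α`, given as an equivalence relation, is a diagram built of `K_d`'s if each
of its blocks has exactly `d` points. -/
def IsDiagram {α : Type*} (d : ℕ) (s : Setoid α) : Prop :=
  ∀ x, {y | s x y}.ncard = d

/-- The labelled loopless generalized chord diagrams consisting of `n` subgraphs `K_d`: partitions
of `d * n` points on a circle into blocks of size `d`, such that any two distinct neighbouring
points lie in different blocks. -/
def LooplessDiagram (d n : ℕ) : Type :=
  {s : Setoid (ZMod (d * n)) // IsDiagram d s ∧ ∀ x, x ≠ x + 1 → ¬ s x (x + 1)}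

/-- The image of a partition under a permutation of the points. -/
def permSetoid {α : Type*} (σ : Equiv.Perm α) (s : Setoid α) : Setoid α :=
  s.comap σ.symm

theorem permSetoid_apply {α : Type*} (σ : Equiv.Perm α) (s : Setoid α) (x y : α) :
    permSetoid σ s x y ↔ s (σ.symm x) (σ.symm y) := Iff.rfl

theorem isDiagram_permSetoid {α : Type*} {d : ℕ} (σ : Equiv.Perm α) {s : Setoid α}
    (hs : IsDiagram d s) : IsDiagram d (permSetoid σ s) := by
  intro x
  have h : {y | permSetoid σ s x y} = σ '' {y | s (σ.symm x) y} := by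
    ext y
    constructor
    · intro h
      exact ⟨σ.symm y, h, σ.apply_symm_apply y⟩
    · rintro ⟨z, hz, rfl⟩
      change s (σ.symm x) (σ.symm (σ z))
      rw [σ.symm_apply_apply]
      exact hz
  rw [h, Set.ncard_image_of_injective _ σ.injective]
  exact hs (σ.symm x)

theorem dihedralPerm_symm_succ (N : ℕ) (g : DihedralGroup N) (x : ZMod N) :
    (dihedralPerm N g).symm (x + 1) = (dihedralPerm N g).symm x + 1 ∨
    (dihedralPerm N g).symm (x + 1) + 1 = (dihedralPerm N g).symm x := by
  rcases g with i | i
  · left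
    rw [Equiv.symm_apply_eq]
    simp only [dihedralPerm, MonoidHom.coe_mk, OneHom.coe_mk, Equiv.coe_addRight,
      Equiv.addRight_symm]
    ring
  · right
    rw [Equiv.eq_symm_apply]
    have h : (dihedralPerm N (DihedralGroup.sr i)).symm (x + 1) = -(x + 1) + -i := rfl
    have h' : ∀ z, dihedralPerm N (DihedralGroup.sr i) z = -i - z := fun _ => rfl
    rw [h, h']
    ring

theorem loopless_permSetoid {N : ℕ} (g : DihedralGroup N) {s : Setoid (ZMod N)}
    (hs : ∀ x, x ≠ x + 1 → ¬ s x (x + 1)) (x : ZMod N) (hx : x ≠ x + 1) :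
    ¬ permSetoid (dihedralPerm N g) s x (x + 1) := by
  rw [permSetoid_apply]
  have hne : (dihedralPerm N g).symm x ≠ (dihedralPerm N g).symm (x + 1) :=
    fun h => hx ((dihedralPerm N g).symm.injective h)
  rcases dihedralPerm_symm_succ N g x with h | h
  · rw [h] at hne ⊢
    exact hs _ hne
  · intro hc
    rw [← h] at hne hc
    exact hs _ hne.symm (s.symm hc)

/-- The dihedral group `D_{dn}` acts on the labelled loopless diagrams. -/
instance dihedralAction (d n : ℕ) : MulAction (DihedralGroup (d * n)) (LooplessDiagram d n) where
  smul g D := ⟨permSetoid (dihedralPerm (d * n) g) D.1,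
    isDiagram_permSetoid _ D.2.1, loopless_permSetoid g D.2.2⟩
  one_smul D := by
    refine Subtype.ext (Setoid.ext fun x y => ?_)
    change permSetoid (dihedralPerm (d * n) 1) D.1 x y ↔ _
    rw [permSetoid_apply, map_one]
    rfl
  mul_smul g h D := by
    refine Subtype.ext (Setoid.ext fun x y => ?_)
    change permSetoid (dihedralPerm (d * n) (g * h)) D.1 x y ↔
      permSetoid (dihedralPerm (d * n) g) (permSetoid (dihedralPerm (d * n) h) D.1) x y
    rw [map_mul]
    rfl

/-- The number of loopless generalized chord diagrams up to rotations and reflections. -/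
noncomputable def numUnlabelled (d n : ℕ) : ℕ :=
  Nat.card (MulAction.orbitRel.Quotient (DihedralGroup (d * n)) (LooplessDiagram d n))

/-- The number of labelled loopless diagrams fixed by an element of the dihedral group. -/
noncomputable def numFixed (d n : ℕ) (g : DihedralGroup (d * n)) : ℕ :=
  Nat.card (MulAction.fixedBy (LooplessDiagram d n) g)

/-- `f(dn, m)`, for `m ∣ dn`: the number of `m`-symmetric loopless diagrams, i.e. of those fixed
by the rotation through `dn / m` steps. -/
noncomputable def rotSym (d n m : ℕ) : ℕ :=
  numFixed d n (DihedralGroup.r ((d * n / m : ℕ) : ZMod (d * n)))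

/-- The number of points lying on the axis of the reflection `x ↦ -a - x` of `N` points. -/
noncomputable def axisPoints (N : ℕ) (a : ZMod N) : ℕ :=
  {x | dihedralPerm N (DihedralGroup.sr a) x = x}.ncard

open Classical in
/-- `h^{(i)}(n)`: the number of loopless diagrams symmetric under the reflection about an axis
passing through exactly `i` points; it is `0` if there is no such axis. -/
noncomputable def reflSym (d n i : ℕ) : ℕ :=
  if h : ∃ a : ZMod (d * n), axisPoints (d * n) a = i then
    numFixed d n (DihedralGroup.sr h.choose)
  else 0

/-- `s` is a generalized `m`-linear diagram with `m` sectors of `v` points each, built of `K_d`'s: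
a partition into blocks of size `d`, invariant under the cyclic shift of the sectors. The point
`(i, p)` is the `p`-th point of the `i`-th sector. -/
def IsMultilinear (m d v : ℕ) (s : Setoid (ZMod m × Fin v)) : Prop :=
  IsDiagram d s ∧ ∀ x y, s x y ↔ s (x.1 + 1, x.2) (y.1 + 1, y.2)

/-- The number of loops in the sector `i`: the number of pairs of consecutive points of that
sector lying in the same block. -/
noncomputable def sectorLoops {m v : ℕ} (s : Setoid (ZMod m × Fin v)) (i : ZMod m) : ℕ :=
  {p : Fin v | ∃ h : (p : ℕ) + 1 < v, s (i, p) (i, ⟨(p : ℕ) + 1, h⟩)}.ncard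

/-- `a_{v,k}^{(m,d)}`: the number of generalized `m`-linear diagrams with `v` points and exactly
`k` loops in each of the `m` sectors. -/
noncomputable def numLinear (m d v k : ℕ) : ℕ :=
  Nat.card {s : Setoid (ZMod m × Fin v) // IsMultilinear m d v s ∧ ∀ i, sectorLoops s i = k}

/-- Binomial coefficients, equal to `0` unless `0 ≤ b ≤ a`. -/
def binom (a b : ℤ) : ℤ :=
  if 0 ≤ b ∧ b ≤ a then (a.toNat.choose b.toNat : ℤ) else 0

/-- `α^{(1)}_k`, for even `d`. -/
def alpha1 (d n k : ℕ) : ℤ :=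
  binom (((n : ℤ) - 1) * (d / 2 : ℕ) - 1 - k) ((d / 2 : ℕ) - 1 - k)

/-- `α^{(3)}_k`, for even `d`. -/
def alpha3 (d n k : ℕ) : ℤ :=
  binom (((n : ℤ) - 1) * (d / 2 : ℕ) - 1 - k) ((d / 2 : ℕ) - 2 - k)

/-- `α^{(2)}_k`, for even `d`. -/
def alpha2 (d n k : ℕ) : ℤ :=
  ∑ j ∈ Finset.range (d / 2), ∑ s ∈ Finset.range (min k (d / 2 - 1 - j) + 1),
    binom ((d / 2 : ℕ) - 1) j * binom k s *
      binom ((d / 2 : ℕ) * ((n : ℤ) - 2) - k) ((d / 2 : ℕ) - 1 - j - s) *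
      binom ((d / 2 : ℕ) * ((n : ℤ) - 1) - 1 - (k + j - s)) ((d / 2 : ℕ) - 1 - (k + j - s))

/-- The (undirected) Hamiltonian cycles of a graph, as sets of edges. -/
def HamCycle {V : Type*} [DecidableEq V] (G : SimpleGraph V) : Type _ :=
  {E : Set (Sym2 V) // ∃ (u : V) (p : G.Walk u u), p.IsHamiltonianCycle ∧ p.edgeSet = E}

/-- Two Hamiltonian cycles of `G` are isomorphic if an automorphism of `G` takes one to the
other. -/
def hamCycleSetoid {V : Type*} [DecidableEq V] (G : SimpleGraph V) : Setoid (HamCycle G) where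
  r C C' := ∃ φ : G ≃g G, Sym2.map φ '' C.1 = C'.1
  iseqv := by
    refine ⟨fun C => ⟨SimpleGraph.Iso.refl, ?_⟩, ?_, ?_⟩
    · have h : Sym2.map (SimpleGraph.Iso.refl : G ≃g G) = id := Sym2.map_id
      rw [h, Set.image_id]
    · rintro C C' ⟨φ, h⟩
      refine ⟨φ.symm, ?_⟩
      rw [← h, ← Set.image_comp, ← Sym2.map_comp]
      have h' : (φ.symm : V → V) ∘ φ = id := funext fun x => φ.symm_apply_apply x
      rw [h', Sym2.map_id, Set.image_id]
    · rintro C C' C'' ⟨φ, h⟩ ⟨ψ, h'⟩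
      refine ⟨φ.trans ψ, ?_⟩
      rw [← h', ← h, ← Set.image_comp, ← Sym2.map_comp]
      rfl

/-- The number of undirected unlabelled Hamiltonian cycles of `G`. -/
noncomputable def numHamCycles {V : Type*} [DecidableEq V] (G : SimpleGraph V) : ℕ :=
  Nat.card (Quotient (hamCycleSetoid G))

end KChord

/-!
The number of orbits is given by Burnside's lemma (`sum_numFixed`). Rotations of the same order
generate the same subgroup, hence fix the same diagrams (`numFixed_r`). A reflection `x ↦ -a - x`
is conjugate to each `x ↦ -(a + 2b) - x`, and two neighbouring axes together represent all types of
axes (`numFixed_sr_add_succ`), which yields the term `(h⁽⁰⁾ + 2h⁽¹⁾ + h⁽²⁾) / 4`.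

The main work is to count the diagrams symmetric under a reflection. Cut along the axis, such a
diagram becomes a partition of two linear sectors, invariant under their exchange
(`FoldShape.card_isReflected`); sector `1` consists of the mirror images of the points of sector
`0`, and a point on the axis is doubled. Points on the axis, and loops across an end of the axis,
thus become conditions on the blocks of the first and of the last points of the sectors: whether
these blocks are symmetric, how large they are, and whether they coincide. If no point lies on the
axis and `d` is even, then inclusion and exclusion over the loops at the two ends reduces the
problem to such blocks (`card_no_point_even`); if `d` is odd, then no block without a point on the
axis is symmetric, so that there are no loops at the ends.

Symmetric blocks at the ends are removed (`sum_removeBlock`), leaving a `2`-linear diagram with `k`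
loops. Conversely, a block is inserted into the gaps behind the remaining points. It is only the
set `D` of occupied gaps that matters for the loops: a loop is destroyed if its gap is in `D`, and
a block that takes `m` positions in each sector besides the first one creates `m - #D` loops. By
Pascal's recursion there are `m.choose #D` ways to insert a block that occupies exactly the gaps in
`D` (`card_placements`). The sums over `D` are then the binomial sums of the formulas
(`card_frontSet_loopless_mem`, `card_frontSet_loopless_notMem`, `card_doubleSet_loopless`).

Finally, consider the cyclic orderings of the vertices of `K_{d,…,d}` in which neighbours lie in
different parts. Every loopless diagram and every Hamiltonian cycle arises from such an ordering.
Two orderings give equivalent diagrams if and only if they give equivalent Hamiltonian cycles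
(`CyclicOrdering.orbitRel_iff`), because a permutation of the circle that takes neighbours to
neighbours belongs to the dihedral group (`exists_dihedralPerm_eq`).
-/

namespace KChord

open Finset

/-! ### Insertion of points into the gaps of a line -/

/-- The `q`-th natural number outside `T`. -/
noncomputable def enum (T : Finset ℕ) (q : ℕ) : ℕ := Nat.nth (· ∉ T) q

/-- The `q < w` such that the gap directly behind the `q`-th number outside `T` is occupied by an
element of `T`. The set `T` represents points inserted into a line of `w` points; the gap before
the first point is not counted. -/
noncomputable def gapSet (T : Finset ℕ) (w : ℕ) : Finset ℕ := {q ∈ range w | enum T q + 1 ∈ T}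

/-- The elements of `T` whose successor is in `T`, too. -/
def adjSet (T : Finset ℕ) : Finset ℕ := {i ∈ T | i + 1 ∈ T}

theorem infinite_compl (T : Finset ℕ) : {i | i ∉ T}.Infinite := by
  have := T.finite_toSet.infinite_compl
  exact this

theorem enum_notMem (T : Finset ℕ) (q : ℕ) : enum T q ∉ T :=
  Nat.nth_mem_of_infinite (infinite_compl T) q

theorem enum_strictMono (T : Finset ℕ) : StrictMono (enum T) :=
  Nat.nth_strictMono (infinite_compl T)

theorem exists_enum_eq {T : Finset ℕ} {i : ℕ} (hi : i ∉ T) : ∃ q, enum T q = i :=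
  ⟨_, Nat.nth_count (p := (· ∉ T)) hi⟩

theorem enum_lt_iff {T : Finset ℕ} {w M : ℕ} (hT : T ⊆ range M) (hM : w + #T = M) (q : ℕ) :
    enum T q < M ↔ q < w := by
  have hc : Nat.count (· ∉ T) M = w := by
    rw [Nat.count_eq_card_filter_range, ← sdiff_eq_filter, card_sdiff_of_subset hT, card_range]
    omega
  have h := Nat.count_le_iff_le_nth (infinite_compl T) (a := M) (b := q)
  rw [hc] at h
  have h' : M ≤ enum T q ↔ w ≤ q := h.symm
  omega

/-- Consecutive numbers outside `T` have consecutive indices. -/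
theorem enum_succ {T : Finset ℕ} {q : ℕ} (h : enum T q + 1 ∉ T) :
    enum T (q + 1) = enum T q + 1 := by
  obtain ⟨r, hr⟩ := exists_enum_eq h
  have h1 : q < r := (enum_strictMono T).lt_iff_lt.1 (by omega)
  have h2 : enum T q < enum T (q + 1) := enum_strictMono T (by omega)
  have h3 : enum T (q + 1) ≤ enum T r := (enum_strictMono T).monotone h1
  omega

theorem gapSet_subset (T : Finset ℕ) (w : ℕ) : gapSet T w ⊆ range w := filter_subset _ _

theorem mem_gapSet {T : Finset ℕ} {w q : ℕ} : q ∈ gapSet T w ↔ q < w ∧ enum T q + 1 ∈ T := by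
  simp [gapSet]

theorem enum_zero {T : Finset ℕ} (h : 0 ∉ T) : enum T 0 = 0 := Nat.nth_zero_of_zero h

/-- The last of the positions belongs to `T` if and only if the gap behind the last number outside
`T` is occupied. -/
theorem last_mem_iff {T : Finset ℕ} {w M : ℕ} (hT : T ⊆ range (M + 1)) (hM : w + 1 + #T = M + 1) :
    M ∈ T ↔ w ∈ gapSet T (w + 1) := by
  have hw := (enum_lt_iff hT hM w).2 (by omega)
  have hw1 := (enum_lt_iff hT hM (w + 1)).not.2 (by omega)
  rw [mem_gapSet]
  refine ⟨fun h => ⟨by omega, ?_⟩, fun h => ?_⟩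
  · by_contra h'
    have h2 := enum_succ h'
    have : enum T w = M := by omega
    exact enum_notMem T w (this ▸ h)
  · by_contra h'
    obtain ⟨r, hr⟩ := exists_enum_eq h'
    have h3 := (enum_lt_iff hT hM r).1 (by omega)
    have h4 : enum T r ≤ enum T w := (enum_strictMono T).monotone (by omega)
    have h5 : enum T w = M := by omega
    have := mem_range.1 (hT h.2)
    omega

/-- The elements of `T` other than `0` are preceded either by an element of `T` or by a number
whose gap is occupied. -/
theorem card_adjSet_add {T : Finset ℕ} {w M : ℕ} (hT : T ⊆ range M) (hM : w + #T = M) :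
    #(adjSet T) + #(gapSet T w) + (if 0 ∈ T then 1 else 0) = #T := by
  have h1 : T.erase 0 = (adjSet T).image (· + 1) ∪ (gapSet T w).image (enum T · + 1) := by
    ext i
    simp only [mem_erase, mem_union, mem_image, adjSet, mem_filter, mem_gapSet]
    constructor
    · rintro ⟨hi0, hi⟩
      obtain ⟨i, rfl⟩ := Nat.exists_eq_succ_of_ne_zero hi0
      by_cases h : i ∈ T
      · exact Or.inl ⟨i, ⟨h, hi⟩, rfl⟩
      · obtain ⟨q, rfl⟩ := exists_enum_eq h
        refine Or.inr ⟨q, ⟨?_, hi⟩, rfl⟩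
        have := mem_range.1 (hT hi)
        exact (enum_lt_iff hT hM q).1 (by omega)
    · rintro (⟨j, ⟨_, h⟩, rfl⟩ | ⟨q, ⟨_, h⟩, rfl⟩)
      · exact ⟨by omega, h⟩
      · exact ⟨by omega, h⟩
  have h2 : Disjoint ((adjSet T).image (· + 1)) ((gapSet T w).image (enum T · + 1)) := by
    rw [disjoint_left]
    intro i hi hi'
    obtain ⟨j, hj, rfl⟩ := mem_image.1 hi
    obtain ⟨q, hq, hqj⟩ := mem_image.1 hi'
    have : enum T q = j := by omega
    exact enum_notMem T q (this ▸ (mem_filter.1 hj).1)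
  have h3 := congrArg card h1
  rw [card_union_of_disjoint h2, card_image_of_injective _ (add_left_injective 1),
    card_image_of_injective _ (fun a b h => (enum_strictMono T).injective (by simpa using h))] at h3
  rw [← h3]
  split_ifs with h0
  · rw [card_erase_of_mem h0]
    have := card_pos.2 ⟨0, h0⟩
    omega
  · rw [erase_eq_of_notMem h0]
    omega

theorem enum_insert_of_lt {T : Finset ℕ} {l q : ℕ} (hq : enum T q < l) :
    enum (insert l T) q = enum T q := by
  have h : Nat.count (· ∉ insert l T) (enum T q) = q := by
    have h' : Nat.count (· ∉ insert l T) (enum T q) = Nat.count (· ∉ T) (enum T q) := by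
      rw [Nat.count_eq_card_filter_range, Nat.count_eq_card_filter_range]
      congr 1
      refine filter_congr fun x hx => ?_
      have := mem_range.1 hx
      rw [mem_insert, not_or]
      exact ⟨And.right, fun h => ⟨by omega, h⟩⟩
    rw [h']
    exact Nat.count_nth_of_infinite (infinite_compl T) q
  have h2 : enum T q ∉ insert l T := by
    rw [mem_insert, not_or]
    exact ⟨hq.ne, enum_notMem T q⟩
  have := Nat.nth_count (p := (· ∉ insert l T)) h2
  rw [h] at this
  exact this

/-- Appending an element of `T` at the end of the line occupies the gap behind the last point and
leaves the other gaps as they are. -/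
theorem gapSet_insert {T : Finset ℕ} {w l : ℕ} (hT : T ⊆ range l) (hl : w + 1 + #T = l) :
    gapSet (insert l T) (w + 1) = insert w (gapSet T w) := by
  have key : ∀ q < w + 1, enum (insert l T) q = enum T q := fun q hq =>
    enum_insert_of_lt ((enum_lt_iff hT hl q).2 hq)
  ext q
  simp only [mem_insert, mem_gapSet]
  rcases lt_trichotomy q w with hq | rfl | hq
  · rw [key q (by omega)]
    have h1 : enum T q < enum T w := enum_strictMono T hq
    have h2 := (enum_lt_iff hT hl w).2 (by omega)
    have h3 : enum T q + 1 ≠ l := by omega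
    have h4 : q ≠ w := by omega
    simp [h3, h4, hq, show q < w + 1 by omega]
  · rw [key q (by omega)]
    simp only [lt_add_iff_pos_right, zero_lt_one, true_and, lt_self_iff_false,
      false_and, or_false, iff_true]
    by_contra! h
    have h2 := (enum_lt_iff hT hl q).2 (by omega)
    have h3 := (enum_lt_iff hT hl (q + 1)).not.2 (by omega)
    have h4 := enum_succ h.2
    omega
  · simp [show ¬ q < w + 1 by omega, show ¬ q < w by omega, show q ≠ w by omega]

theorem gapSet_of_subset {T : Finset ℕ} {w l : ℕ} (hT : T ⊆ range l) (hl : w + #T = l) :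
    gapSet T (w + 1) = gapSet T w := by
  ext q
  rw [mem_gapSet, mem_gapSet]
  refine ⟨fun ⟨h1, h2⟩ => ⟨?_, h2⟩, fun ⟨h1, h2⟩ => ⟨by omega, h2⟩⟩
  have := mem_range.1 (hT h2)
  exact (enum_lt_iff hT hl q).1 (by omega)

/-- The sets of `m + f` positions on a line of `w + m + f` points that start with `f` given ones
and occupy a prescribed set `D` of gaps. -/
noncomputable def placements (f w m : ℕ) (D : Finset ℕ) : Finset (Finset ℕ) :=
  {T ∈ powersetCard (m + f) (range (w + m + f)) | range f ⊆ T ∧ gapSet T w = D}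

theorem mem_placements {f w m : ℕ} {D T : Finset ℕ} : T ∈ placements f w m D ↔
    (T ⊆ range (w + m + f) ∧ #T = m + f) ∧ range f ⊆ T ∧ gapSet T w = D := by
  rw [placements, mem_filter, mem_powersetCard]

/-- Splitting off the last position. If it is in `T`, then it occupies the last gap, which may or
may not be occupied after its removal; if it is not in `T`, then the last gap is empty. So the
numbers of placements satisfy Pascal's recursion. -/
theorem card_placements (f : ℕ) : ∀ (w m : ℕ) (D : Finset ℕ), D ⊆ range w →
    #(placements f w m D) = m.choose #D := by
  intro w
  induction w with
  | zero =>
    intro m D hD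
    obtain rfl : D = ∅ := by simpa using hD
    rw [card_empty, Nat.choose_zero_right, card_eq_one]
    refine ⟨range (m + f), ?_⟩
    ext T
    rw [mem_placements, mem_singleton]
    constructor
    · rintro ⟨⟨h1, h2⟩, -, -⟩
      refine eq_of_subset_of_card_le (by simpa using h1) ?_
      rw [card_range, h2]
    · rintro rfl
      refine ⟨⟨by simp, by simp⟩, range_mono (by omega), by simp [gapSet]⟩
  | succ w ihw =>
    intro m
    induction m with
    | zero =>
      intro D hD
      have hT : ∀ T, T ∈ placements f (w + 1) 0 D ↔ T = range f ∧ D = ∅ := by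
        intro T
        rw [mem_placements]
        constructor
        · rintro ⟨⟨h1, h2⟩, h3, h4⟩
          have h5 : T = range f := (eq_of_subset_of_card_le h3 (by simp [h2])).symm
          refine ⟨h5, ?_⟩
          rw [← h4, h5, eq_empty_iff_forall_notMem]
          intro q hq
          rw [mem_gapSet] at hq
          have h6 := mem_range.1 hq.2
          exact enum_notMem (range f) q (mem_range.2 (by omega))
        · rintro ⟨rfl, rfl⟩
          refine ⟨⟨range_mono (by omega), by simp⟩, Subset.rfl, ?_⟩
          rw [eq_empty_iff_forall_notMem]
          intro q hq
          rw [mem_gapSet] at hq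
          have h6 := mem_range.1 hq.2
          exact enum_notMem (range f) q (mem_range.2 (by omega))
      rcases eq_or_ne D ∅ with rfl | hD0
      · rw [card_empty, Nat.choose_zero_right, card_eq_one]
        exact ⟨range f, by ext T; simp [hT]⟩
      · rw [Nat.choose_eq_zero_of_lt (card_pos.2 (nonempty_iff_ne_empty.2 hD0)), card_eq_zero,
          eq_empty_iff_forall_notMem]
        intro T h
        exact hD0 ((hT T).1 h).2
    | succ m ihm =>
      intro D hD
      set l := w + 1 + m + f with hl
      have hlr : ∀ {T : Finset ℕ}, T ⊆ range (w + 1 + (m + 1) + f) → l ∉ T → T ⊆ range l := by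
        intro T h1 h2 x hx
        have := mem_range.1 (h1 hx)
        have : x ≠ l := fun h => h2 (h ▸ hx)
        exact mem_range.2 (by omega)
      -- placements without the last position are placements on a line with one point less
      have hout : #{T ∈ placements f (w + 1) (m + 1) D | l ∉ T}
          = if w ∈ D then 0 else (m + 1).choose #D := by
        split_ifs with hw
        · rw [card_eq_zero, eq_empty_iff_forall_notMem]
          intro T hT
          rw [mem_filter, mem_placements] at hT
          obtain ⟨⟨⟨h1, h2⟩, -, h3⟩, h4⟩ := hT
          rw [← h3, gapSet_of_subset (hlr h1 h4) (by omega), mem_gapSet] at hw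
          omega
        · rw [← ihw (m + 1) D (fun x hx => by
            have := mem_range.1 (hD hx)
            have : x ≠ w := fun h => hw (h ▸ hx)
            exact mem_range.2 (by omega))]
          congr 1
          ext T
          rw [mem_filter, mem_placements, mem_placements]
          constructor
          · rintro ⟨⟨⟨h1, h2⟩, h0, h3⟩, h4⟩
            have h5 := hlr h1 h4
            refine ⟨⟨h5.trans (range_mono (by omega)), h2⟩, h0, ?_⟩
            rw [← h3, gapSet_of_subset h5 (by omega)]
          · rintro ⟨⟨h1, h2⟩, h0, h3⟩
            have h5 : T ⊆ range l := h1.trans (range_mono (by omega))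
            refine ⟨⟨⟨h5.trans (range_mono (by omega)), h2⟩, h0, ?_⟩, fun h => ?_⟩
            · rw [← h3, gapSet_of_subset h5 (by omega)]
            · simpa using h5 h
      -- removing the last position
      have hin : #{T ∈ placements f (w + 1) (m + 1) D | l ∈ T}
          = if w ∈ D then m.choose #D + m.choose (#D - 1) else 0 := by
        have hgap : ∀ T' : Finset ℕ, T' ⊆ range l → #T' = m + f →
            gapSet (insert l T') (w + 1) = insert w (gapSet T' (w + 1)) := by
          intro T' h1 h2
          rw [gapSet_insert h1 (by omega)]
          ext q
          simp only [mem_insert, mem_gapSet]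
          constructor
          · rintro (rfl | h)
            · exact Or.inl rfl
            · exact Or.inr ⟨by omega, h.2⟩
          · rintro (rfl | h)
            · exact Or.inl rfl
            · rcases eq_or_ne q w with rfl | hq
              · exact Or.inl rfl
              · exact Or.inr ⟨by omega, h.2⟩
        have himg : {T ∈ placements f (w + 1) (m + 1) D | l ∈ T} =
            ({T ∈ powersetCard (m + f) (range l) | range f ⊆ T ∧
              insert w (gapSet T (w + 1)) = D}).image (insert l) := by
          ext T
          rw [mem_filter, mem_placements, mem_image]
          constructor
          · rintro ⟨⟨⟨h1, h2⟩, h0, h3⟩, h4⟩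
            have h5 : T.erase l ⊆ range l :=
              hlr ((erase_subset _ _).trans h1) (notMem_erase _ _)
            have h6 : #(T.erase l) = m + f := by rw [card_erase_of_mem h4]; omega
            refine ⟨T.erase l, ?_, insert_erase h4⟩
            rw [mem_filter, mem_powersetCard]
            refine ⟨⟨h5, h6⟩, ?_, ?_⟩
            · intro x hx
              have := mem_range.1 hx
              exact mem_erase.2 ⟨by omega, h0 hx⟩
            · rw [← hgap _ h5 h6, insert_erase h4, h3]
          · rintro ⟨T', h, rfl⟩
            rw [mem_filter, mem_powersetCard] at h
            obtain ⟨⟨h5, h6⟩, h0, h3⟩ := h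
            have hlT : l ∉ T' := fun h => by simpa using h5 h
            refine ⟨⟨⟨?_, ?_⟩, h0.trans (subset_insert _ _), ?_⟩, mem_insert_self _ _⟩
            · rw [insert_subset_iff]
              exact ⟨mem_range.2 (by omega), h5.trans (range_mono (by omega))⟩
            · rw [card_insert_of_notMem hlT]; omega
            · rw [hgap _ h5 h6, h3]
        rw [himg, card_image_of_injOn]
        · split_ifs with hw
          · have hsplit : {T ∈ powersetCard (m + f) (range l) | range f ⊆ T ∧
                insert w (gapSet T (w + 1)) = D} =
                placements f (w + 1) m D ∪ placements f (w + 1) m (D.erase w) := by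
              ext T
              rw [mem_filter, mem_union, mem_placements, mem_placements, mem_powersetCard]
              constructor
              · rintro ⟨h1, h2, h3⟩
                by_cases h4 : w ∈ gapSet T (w + 1)
                · exact Or.inl ⟨h1, h2, by rw [← h3, insert_eq_of_mem h4]⟩
                · exact Or.inr ⟨h1, h2, by rw [← h3, erase_insert h4]⟩
              · rintro (⟨h1, h2, h3⟩ | ⟨h1, h2, h3⟩)
                · exact ⟨h1, h2, by rw [h3, insert_eq_of_mem hw]⟩
                · exact ⟨h1, h2, by rw [h3, insert_erase hw]⟩
            rw [hsplit, card_union_of_disjoint, ihm D hD, ihm _ ((erase_subset _ _).trans hD),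
              card_erase_of_mem hw]
            rw [disjoint_left]
            intro T h1 h2
            have h3 := (mem_placements.1 h1).2.2.symm.trans (mem_placements.1 h2).2.2
            rw [h3] at hw
            exact notMem_erase _ _ hw
          · rw [card_eq_zero, eq_empty_iff_forall_notMem]
            intro T hT
            exact hw ((mem_filter.1 hT).2.2 ▸ mem_insert_self _ _)
        · intro T1 h1 T2 h2 h12
          have hl1 : ∀ T ∈ ({T ∈ powersetCard (m + f) (range l) | range f ⊆ T ∧
              insert w (gapSet T (w + 1)) = D} : Finset (Finset ℕ)), l ∉ T := by
            intro T hT h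
            simpa using (mem_powersetCard.1 (mem_filter.1 hT).1).1 h
          rw [← erase_insert (hl1 T1 h1), ← erase_insert (hl1 T2 h2)]
          exact congrArg (fun T => erase T l) h12
      rw [← card_filter_add_card_filter_not (fun T => l ∈ T), hin, hout]
      split_ifs with hw
      · obtain ⟨c, hc⟩ : ∃ c, #D = c + 1 := ⟨#D - 1, by have := card_pos.2 ⟨w, hw⟩; omega⟩
        rw [hc, Nat.choose_succ_succ', Nat.add_sub_cancel]
        omega
      · omega

/-- Summing over the placements by the set of gaps that they occupy. -/
theorem sum_placements {R : Type*} [Semiring R] (f w m : ℕ) (g : Finset ℕ → R) :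
    ∑ T ∈ powersetCard (m + f) (range (w + m + f)) with range f ⊆ T, g (gapSet T w) =
      ∑ D ∈ (range w).powerset, (m.choose #D : R) * g D := by
  rw [← sum_fiberwise_of_maps_to (t := (range w).powerset) (g := fun T => gapSet T w)
    (fun T _ => mem_powerset.2 (gapSet_subset T w))]
  refine sum_congr rfl fun D hD => ?_
  rw [filter_filter, sum_congr rfl (g := fun _ => g D), sum_const, nsmul_eq_mul]
  · congr 2
    exact card_placements f w m D (mem_powerset.1 hD)
  · intro T hT
    rw [(mem_filter.1 hT).2.2]

/-! ### Choosing the occupied gaps -/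

theorem binom_natCast {a b : ℕ} (h : b ≤ a) : binom a b = (a.choose b : ℤ) := by
  simp [binom, h]

theorem binom_natCast' (a b : ℕ) : binom a b = (a.choose b : ℤ) := by
  rcases le_or_gt b a with h | h
  · exact binom_natCast h
  · rw [Nat.choose_eq_zero_of_lt h]
    simp [binom, h]

theorem binom_eq_zero {a b : ℤ} (h : b < 0 ∨ a < b) : binom a b = 0 := by
  rw [binom, if_neg (by omega)]

theorem binom_eq_choose {a b : ℤ} {a' b' : ℕ} (ha : a = a') (hb : b = b') :
    binom a b = (a'.choose b' : ℤ) := by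
  rw [ha, hb, binom_natCast']

/-- The number of sets of `t` gaps that contain a given set of gaps. -/
theorem card_filter_superset {w t : ℕ} {A : Finset ℕ} (hA : A ⊆ range w) :
    (#{D ∈ powersetCard t (range w) | A ⊆ D} : ℤ) = binom ((w : ℤ) - #A) ((t : ℤ) - #A) := by
  have hAw : #A ≤ w := by simpa using card_le_card hA
  rcases lt_or_ge t #A with h | h
  · rw [binom_eq_zero (by omega), Nat.cast_eq_zero, card_eq_zero, eq_empty_iff_forall_notMem]
    intro D hD
    rw [mem_filter, mem_powersetCard] at hD
    have := card_le_card hD.2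
    omega
  · rw [binom_eq_choose (a' := w - #A) (b' := t - #A) (by omega) (by omega), Nat.cast_inj,
      show w - #A = #(range w \ A) by rw [card_sdiff_of_subset hA, card_range],
      ← card_powersetCard]
    refine card_bij' (fun D _ => D \ A) (fun D _ => D ∪ A) ?_ ?_ ?_ ?_
    · intro D hD
      rw [mem_filter, mem_powersetCard] at hD
      rw [mem_powersetCard, card_sdiff_of_subset hD.2, hD.1.2]
      exact ⟨sdiff_subset_sdiff hD.1.1 Subset.rfl, rfl⟩
    · intro D hD
      rw [mem_powersetCard] at hD
      rw [mem_filter, mem_powersetCard]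
      have hd : Disjoint D A := disjoint_of_subset_left hD.1 sdiff_disjoint
      refine ⟨⟨union_subset (hD.1.trans sdiff_subset) hA, ?_⟩, subset_union_right⟩
      rw [card_union_of_disjoint hd]
      omega
    · intro D hD
      exact sdiff_union_of_subset (mem_filter.1 hD).2
    · intro D hD
      have hd : Disjoint D A := disjoint_of_subset_left (mem_powersetCard.1 hD).1 sdiff_disjoint
      exact union_sdiff_cancel_right hd

/-- The number of sets of `t` gaps that meet a given set of gaps in `s` elements. -/
theorem card_filter_inter {w t s : ℕ} {L : Finset ℕ} (hL : L ⊆ range w) (hs : s ≤ t) :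
    #{D ∈ powersetCard t (range w) | #(L ∩ D) = s} =
      (#L).choose s * (w - #L).choose (t - s) := by
  rw [show w - #L = #(range w \ L) by rw [card_sdiff_of_subset hL, card_range],
    ← card_powersetCard s L, ← card_powersetCard (t - s), ← card_product]
  have hdis : ∀ P : Finset ℕ × Finset ℕ,
      P ∈ powersetCard s L ×ˢ powersetCard (t - s) (range w \ L) →
      P.1 ⊆ L ∧ P.2 ⊆ range w ∧ Disjoint P.2 L ∧ Disjoint P.1 P.2 ∧ #P.1 = s ∧ #P.2 = t - s := by
    rintro ⟨A, B⟩ h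
    rw [mem_product, mem_powersetCard, mem_powersetCard] at h
    have h1 : Disjoint B L := disjoint_of_subset_left h.2.1 sdiff_disjoint
    exact ⟨h.1.1, h.2.1.trans sdiff_subset, h1, (disjoint_of_subset_right h.1.1 h1).symm,
      h.1.2, h.2.2⟩
  refine card_bij' (fun D _ => (L ∩ D, D \ L)) (fun P _ => P.1 ∪ P.2) ?_ ?_ ?_ ?_
  · intro D hD
    rw [mem_filter, mem_powersetCard] at hD
    rw [mem_product, mem_powersetCard, mem_powersetCard]
    refine ⟨⟨inter_subset_left, hD.2⟩, sdiff_subset_sdiff hD.1.1 Subset.rfl,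
      (?_ : #(D \ L) = t - s)⟩
    have := card_inter_add_card_sdiff D L
    rw [inter_comm] at this
    omega
  · intro P hP
    obtain ⟨h1, h2, h3, h4, h5, h6⟩ := hdis P hP
    rw [mem_filter, mem_powersetCard]
    refine ⟨⟨union_subset (h1.trans hL) h2, ?_⟩, ?_⟩
    · rw [card_union_of_disjoint h4]
      omega
    · rw [inter_union_distrib_left, inter_eq_right.2 h1, inter_comm,
        disjoint_iff_inter_eq_empty.1 h3, union_empty, h5]
  · intro D hD
    ext x
    simp only [mem_union, mem_inter, mem_sdiff]
    tauto
  · intro P hP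
    obtain ⟨h1, h2, h3, h4, h5, h6⟩ := hdis P hP
    refine Prod.ext ?_ ?_
    · change L ∩ (P.1 ∪ P.2) = P.1
      rw [inter_union_distrib_left, inter_eq_right.2 h1, inter_comm,
        disjoint_iff_inter_eq_empty.1 h3, union_empty]
    · change (P.1 ∪ P.2) \ L = P.2
      rw [union_sdiff_distrib, sdiff_eq_empty_iff_subset.2 h1, empty_union,
        sdiff_eq_self_of_disjoint h3]

/-! ### Removing a symmetric block -/

/-- The partition `s` of two sectors of `M` points is invariant under the exchange of the
sectors. -/
def SwapInv {M : ℕ} (s : Setoid (ZMod 2 × Fin M)) : Prop :=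
  ∀ x y, s x y ↔ s (x.1 + 1, x.2) (y.1 + 1, y.2)

/-- The `p`-th points of the two sectors lie in a common block. -/
def Axial {M : ℕ} (s : Setoid (ZMod 2 × Fin M)) (p : ℕ) : Prop :=
  ∃ hp : p < M, s (0, ⟨p, hp⟩) (1, ⟨p, hp⟩)

open Classical in
/-- The positions of those points of sector `0` that lie in the block of its `p`-th point. -/
noncomputable def blk {M : ℕ} (s : Setoid (ZMod 2 × Fin M)) (p : ℕ) : Finset ℕ :=
  {q ∈ range M | ∃ (hp : p < M) (hq : q < M), s (0, ⟨p, hp⟩) (0, ⟨q, hq⟩)}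

open Classical in
/-- The positions in sector `0` at which a loop starts. -/
noncomputable def loopSet {M : ℕ} (s : Setoid (ZMod 2 × Fin M)) : Finset ℕ :=
  {p ∈ range M | ∃ (hp : p < M) (h : p + 1 < M), s (0, ⟨p, hp⟩) (0, ⟨p + 1, h⟩)}

/-- The points of both sectors at the positions in `T` form a block of `s` (if there are any). -/
def IsBlock {M : ℕ} (s : Setoid (ZMod 2 × Fin M)) (T : Finset ℕ) : Prop :=
  ∀ x y, (x.2 : ℕ) ∈ T → (s x y ↔ (y.2 : ℕ) ∈ T)

section
variable {M : ℕ} {s : Setoid (ZMod 2 × Fin M)}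

theorem mem_blk {p q : ℕ} : q ∈ blk s p ↔
    ∃ (hp : p < M) (hq : q < M), s (0, ⟨p, hp⟩) (0, ⟨q, hq⟩) := by
  classical
  refine mem_filter.trans ?_
  rw [mem_range]
  exact ⟨And.right, fun h => ⟨h.2.1, h⟩⟩

theorem mem_loopSet {p : ℕ} : p ∈ loopSet s ↔
    ∃ (hp : p < M) (h : p + 1 < M), s (0, ⟨p, hp⟩) (0, ⟨p + 1, h⟩) := by
  classical
  refine mem_filter.trans ?_
  rw [mem_range]
  exact ⟨And.right, fun h => ⟨h.1, h⟩⟩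

theorem blk_subset (p : ℕ) : blk s p ⊆ range M := fun _ h => mem_range.2 (mem_blk.1 h).2.1

theorem loopSet_subset : loopSet s ⊆ range (M - 1) := fun p h => by
  have := (mem_loopSet.1 h).2.1
  exact mem_range.2 (by omega)

theorem self_mem_blk {p : ℕ} (hp : p < M) : p ∈ blk s p := mem_blk.2 ⟨hp, hp, s.refl _⟩

theorem zmod_two_cases (i : ZMod 2) : i = 0 ∨ i = 1 := by
  revert i
  decide

theorem SwapInv.zero_zero (hs : SwapInv s) (a b : Fin M) : s (0, a) (0, b) ↔ s (1, a) (1, b) :=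
  hs _ _

theorem Axial.isBlock (hs : SwapInv s) {p : ℕ} (h : Axial s p) : IsBlock s (blk s p) := by
  obtain ⟨hp, h⟩ := h
  -- every point at a position of the block is equivalent to the `p`-th point of sector `0`
  have key : ∀ x : ZMod 2 × Fin M, (x.2 : ℕ) ∈ blk s p ↔ s (0, ⟨p, hp⟩) x := by
    rintro ⟨i, a⟩
    rw [mem_blk]
    rcases zmod_two_cases i with rfl | rfl
    · exact ⟨fun h => h.2.2, fun h => ⟨hp, a.2, h⟩⟩
    · constructor
      · rintro ⟨_, _, h'⟩
        exact s.trans h ((hs.zero_zero _ _).1 h')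
      · intro h'
        exact ⟨hp, a.2, (hs.zero_zero _ _).2 (s.trans (s.symm h) h')⟩
  intro x y hx
  rw [key] at hx ⊢
  exact ⟨fun h => s.trans hx h, fun h => s.trans (s.symm hx) h⟩

theorem IsBlock.axial {T : Finset ℕ} (h : IsBlock s T) {p : ℕ} (hpT : p ∈ T) (hp : p < M) :
    Axial s p := ⟨hp, (h _ _ hpT).2 hpT⟩

theorem IsBlock.blk_eq {T : Finset ℕ} (h : IsBlock s T) (hT : T ⊆ range M) {p : ℕ}
    (hpT : p ∈ T) : blk s p = T := by
  have hp := mem_range.1 (hT hpT)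
  ext q
  rw [mem_blk]
  constructor
  · rintro ⟨_, hq, h'⟩
    exact (h _ _ hpT).1 h'
  · intro hq
    exact ⟨hp, mem_range.1 (hT hq), (h _ _ hpT).2 hq⟩

theorem IsBlock.not_rel {T : Finset ℕ} (h : IsBlock s T) {x y : ZMod 2 × Fin M}
    (hx : (x.2 : ℕ) ∈ T) (hy : (y.2 : ℕ) ∉ T) : ¬ s y x := fun h' =>
  hy ((h x y hx).1 (s.symm h'))

theorem ncard_class {T : Finset ℕ} (hT : T ⊆ range M) (h : IsBlock s T) {x : ZMod 2 × Fin M}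
    (hx : (x.2 : ℕ) ∈ T) : {y | s x y}.ncard = 2 * #T := by
  have h1 : {y | s x y} = (univ ×ˢ T.attach.image (fun q => (⟨q.1, mem_range.1 (hT q.2)⟩ : Fin M)) :
      Finset (ZMod 2 × Fin M)) := by
    ext y
    simp only [Set.mem_ofPred_eq, h x y hx, coe_product, coe_univ, coe_image, Set.mem_prod,
      Set.mem_univ, true_and, Set.mem_image]
    constructor
    · intro hy
      exact ⟨⟨y.2, hy⟩, by simp, rfl⟩
    · rintro ⟨q, -, hq⟩
      rw [← hq]
      exact q.2
  rw [h1, Set.ncard_coe_finset, card_product, card_image_of_injective, card_attach]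
  · rfl
  · intro a b hab
    exact Subtype.ext (congrArg Fin.val hab)

end

/-- The increasing enumeration of the positions outside `T`, in both sectors. The reduction modulo
`M + 1` in `Fin.ofNat` has no effect if `T` leaves `w` of the `M + 1` positions free; see
`embed_val`. -/
noncomputable def embed {w : ℕ} (M : ℕ) (T : Finset ℕ) (x : ZMod 2 × Fin w) :
    ZMod 2 × Fin (M + 1) := (x.1, Fin.ofNat (M + 1) (enum T x.2))

section
variable {w M : ℕ} {T : Finset ℕ}

theorem embed_val (hT : T ⊆ range (M + 1)) (hM : w + #T = M + 1) (x : ZMod 2 × Fin w) :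
    ((embed M T x).2 : ℕ) = enum T x.2 :=
  Nat.mod_eq_of_lt ((enum_lt_iff hT hM _).2 x.2.2)

theorem embed_injective (hT : T ⊆ range (M + 1)) (hM : w + #T = M + 1) :
    Function.Injective (embed (w := w) M T) := by
  intro x y h
  refine Prod.ext (congrArg (fun z => z.1) h :) (Fin.ext ((enum_strictMono T).injective ?_))
  rw [← embed_val hT hM, ← embed_val hT hM, h]

theorem exists_embed_eq (hT : T ⊆ range (M + 1)) (hM : w + #T = M + 1) {x : ZMod 2 × Fin (M + 1)}
    (hx : (x.2 : ℕ) ∉ T) : ∃ y : ZMod 2 × Fin w, embed M T y = x := by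
  obtain ⟨q, hq⟩ := exists_enum_eq hx
  have hqw : q < w := (enum_lt_iff hT hM q).1 (hq ▸ x.2.2)
  refine ⟨(x.1, ⟨q, hqw⟩), Prod.ext rfl (Fin.ext ?_)⟩
  rw [embed_val hT hM]
  exact hq

theorem embed_notMem (hT : T ⊆ range (M + 1)) (hM : w + #T = M + 1) (x : ZMod 2 × Fin w) :
    ((embed M T x).2 : ℕ) ∉ T := by
  rw [embed_val hT hM]
  exact enum_notMem T _

theorem embed_mk (hT : T ⊆ range (M + 1)) (hM : w + #T = M + 1) (i : ZMod 2) {q : ℕ} (hq : q < w) :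
    embed M T (i, ⟨q, hq⟩) = (i, ⟨enum T q, (enum_lt_iff hT hM q).2 hq⟩) :=
  Prod.ext rfl (Fin.ext (embed_val hT hM _))

theorem SwapInv.comap_embed {s : Setoid (ZMod 2 × Fin (M + 1))} (hs : SwapInv s) :
    SwapInv (s.comap (embed (w := w) M T)) :=
  fun x y => hs (embed M T x) (embed M T y)

/-- A partition is determined by one of its blocks and its restriction to the other points. -/
theorem IsBlock.ext_of_comap (hT : T ⊆ range (M + 1)) (hM : w + #T = M + 1)
    {s t : Setoid (ZMod 2 × Fin (M + 1))} (hs : IsBlock s T) (ht : IsBlock t T)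
    (h : s.comap (embed (w := w) M T) = t.comap (embed M T)) : s = t := by
  refine Setoid.ext fun x y => ?_
  by_cases hx : (x.2 : ℕ) ∈ T
  · rw [hs x y hx, ht x y hx]
  by_cases hy : (y.2 : ℕ) ∈ T
  · exact iff_of_false (hs.not_rel hy hx) (ht.not_rel hy hx)
  obtain ⟨x, rfl⟩ := exists_embed_eq hT hM hx
  obtain ⟨y, rfl⟩ := exists_embed_eq hT hM hy
  exact Setoid.ext_iff.1 h x y

open Classical in
/-- Every symmetric partition of the points outside `T` extends to a symmetric partition with the
block `T`. -/
theorem exists_isBlock_comap_eq (hT : T ⊆ range (M + 1)) (hM : w + #T = M + 1)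
    {s' : Setoid (ZMod 2 × Fin w)} (hs' : SwapInv s') :
    ∃ s, SwapInv s ∧ IsBlock s T ∧ s.comap (embed M T) = s' := by
  -- a label for each block: `none` for the new one, `some` of a block of `s'` for the others
  set r : ZMod 2 × Fin (M + 1) → Option (Quotient s') := fun x =>
    if h : (x.2 : ℕ) ∈ T then none else some ⟦(exists_embed_eq hT hM h).choose⟧ with hr
  have hrT : ∀ x : ZMod 2 × Fin (M + 1), (x.2 : ℕ) ∈ T → r x = none := fun x hx => dif_pos hx
  have hrE : ∀ y : ZMod 2 × Fin w, r (embed M T y) = some ⟦y⟧ := by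
    intro y
    have h := embed_notMem hT hM y
    rw [hr]
    simp only [dif_neg h, Option.some.injEq]
    rw [embed_injective hT hM (exists_embed_eq hT hM h).choose_spec]
  have hblock : IsBlock (Setoid.ker r) T := by
    intro x y hx
    rw [Setoid.ker_def, hrT x hx]
    refine ⟨fun h => ?_, fun h => (hrT y h).symm⟩
    by_contra hy
    obtain ⟨y, rfl⟩ := exists_embed_eq hT hM hy
    rw [hrE] at h
    cases h
  have hcomap : (Setoid.ker r).comap (embed M T) = s' := by
    refine Setoid.ext fun x y => ?_
    rw [Setoid.comap_rel, Setoid.ker_def, hrE, hrE, Option.some_inj]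
    exact Quotient.eq
  refine ⟨_, fun x y => ?_, hblock, hcomap⟩
  by_cases hx : (x.2 : ℕ) ∈ T
  · rw [hblock x y hx, hblock (x.1 + 1, x.2) (y.1 + 1, y.2) hx]
  by_cases hy : (y.2 : ℕ) ∈ T
  · exact iff_of_false (hblock.not_rel hy hx)
      (hblock.not_rel (x := (y.1 + 1, y.2)) (y := (x.1 + 1, x.2)) hy hx)
  obtain ⟨x, rfl⟩ := exists_embed_eq hT hM hx
  obtain ⟨y, rfl⟩ := exists_embed_eq hT hM hy
  have h := hs' x y
  rw [← hcomap] at h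
  exact h

/-- Symmetric partitions with a symmetric block containing the points at position `p`, summed over
the possible sets of positions of that block. -/
theorem sum_removeBlock {R : Type*} [AddCommMonoid R] {c p : ℕ} (hM : w + c = M + 1)
    (X : Finset (Setoid (ZMod 2 × Fin (M + 1)))) (Y : Finset (Setoid (ZMod 2 × Fin w)))
    (𝒯 : Finset (Finset ℕ)) (h𝒯 : ∀ T ∈ 𝒯, T ⊆ range (M + 1) ∧ #T = c ∧ p ∈ T)
    (hX : ∀ s ∈ X, SwapInv s ∧ Axial s p ∧ blk s p ∈ 𝒯) (hY : ∀ s' ∈ Y, SwapInv s')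
    (hXY : ∀ T ∈ 𝒯, ∀ s, SwapInv s → IsBlock s T → (s ∈ X ↔ s.comap (embed M T) ∈ Y))
    (W : Setoid (ZMod 2 × Fin (M + 1)) → R) (W' : Finset ℕ → Setoid (ZMod 2 × Fin w) → R)
    (hW : ∀ T ∈ 𝒯, ∀ s ∈ X, IsBlock s T → W s = W' T (s.comap (embed M T))) :
    ∑ s ∈ X, W s = ∑ s' ∈ Y, ∑ T ∈ 𝒯, W' T s' := by
  rw [← sum_product']
  refine sum_bij (fun s _ => (s.comap (embed M (blk s p)), blk s p)) ?_ ?_ ?_ ?_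
  · intro s hs
    obtain ⟨h1, h2, h3⟩ := hX s hs
    exact mem_product.2 ⟨(hXY _ h3 s h1 (h2.isBlock h1)).1 hs, h3⟩
  · intro s hs t ht hst
    obtain ⟨h1, h2, h3⟩ := hX s hs
    obtain ⟨h1', h2', h3'⟩ := hX t ht
    have hb : blk s p = blk t p := congrArg Prod.snd hst
    obtain ⟨h4, h5, -⟩ := h𝒯 _ h3
    refine IsBlock.ext_of_comap (w := w) h4 (by omega) (h2.isBlock h1) (hb ▸ h2'.isBlock h1') ?_
    have := congrArg Prod.fst hst
    rw [← hb] at this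
    exact this
  · rintro ⟨s', T⟩ h
    obtain ⟨h1 : s' ∈ Y, h2 : T ∈ 𝒯⟩ := mem_product.1 h
    obtain ⟨h4, h5, h6⟩ := h𝒯 _ h2
    obtain ⟨s, hs, hsT, rfl⟩ := exists_isBlock_comap_eq h4 (by omega) (hY _ h1)
    have hb := hsT.blk_eq h4 h6
    exact ⟨s, (hXY T h2 s hs hsT).2 h1, by rw [hb]⟩
  · intro s hs
    obtain ⟨h1, h2, h3⟩ := hX s hs
    exact hW _ h3 s hs (h2.isBlock h1)

theorem ncard_class_embed (hT : T ⊆ range (M + 1)) (hM : w + #T = M + 1)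
    {s : Setoid (ZMod 2 × Fin (M + 1))} (hs : IsBlock s T) (x : ZMod 2 × Fin w) :
    {y | s (embed M T x) y}.ncard = {y | s.comap (embed M T) x y}.ncard := by
  rw [← Set.ncard_image_of_injective {y | s.comap (embed M T) x y} (embed_injective hT hM)]
  congr 1
  ext y
  constructor
  · intro h
    have hy : (y.2 : ℕ) ∉ T := fun hy => hs.not_rel hy (embed_notMem hT hM x) h
    obtain ⟨y, rfl⟩ := exists_embed_eq hT hM hy
    exact ⟨y, h, rfl⟩
  · rintro ⟨y, h, rfl⟩
    exact h

/-- Inserting the block `T` creates a loop for every pair of consecutive elements of `T` and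
destroys the loops whose gap it occupies. -/
theorem card_loopSet (hT : T ⊆ range (M + 1)) (hM : w + #T = M + 1)
    {s : Setoid (ZMod 2 × Fin (M + 1))} (hs : IsBlock s T) :
    #(loopSet s) = #(adjSet T) + #(loopSet (s.comap (embed (w := w) M T)) \ gapSet T w) := by
  have h1 : loopSet s =
      adjSet T ∪ (loopSet (s.comap (embed (w := w) M T)) \ gapSet T w).image (enum T) := by
    ext p
    rw [mem_loopSet, mem_union, adjSet, mem_filter, mem_image]
    constructor
    · rintro ⟨hp, hp1, h⟩
      by_cases hpT : p ∈ T
      · exact Or.inl ⟨hpT, (hs _ _ hpT).1 h⟩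
      · have hp1T : p + 1 ∉ T := fun h' => hs.not_rel (x := (0, ⟨p + 1, hp1⟩)) h' hpT h
        obtain ⟨q, rfl⟩ := exists_enum_eq hpT
        have hq1 := enum_succ hp1T
        have hqw : q + 1 < w := (enum_lt_iff hT hM _).1 (by omega)
        refine Or.inr ⟨q, ?_, rfl⟩
        rw [mem_sdiff, mem_gapSet, mem_loopSet]
        refine ⟨⟨by omega, hqw, ?_⟩, fun h => hp1T h.2⟩
        rw [Setoid.comap_rel, embed_mk hT hM, embed_mk hT hM]
        convert h using 3
    · rintro (⟨hp, hp1⟩ | ⟨q, hq, rfl⟩)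
      · exact ⟨mem_range.1 (hT hp), mem_range.1 (hT hp1), (hs _ _ hp).2 hp1⟩
      · rw [mem_sdiff, mem_gapSet, mem_loopSet] at hq
        obtain ⟨⟨hqw, hqw1, h⟩, hg⟩ := hq
        have hq1 := enum_succ (fun h => hg ⟨hqw, h⟩)
        have h1 := (enum_lt_iff hT hM _).2 hqw1
        refine ⟨by omega, by omega, ?_⟩
        rw [Setoid.comap_rel, embed_mk hT hM, embed_mk hT hM] at h
        convert h using 3
        exact hq1.symm
  rw [h1, card_union_of_disjoint, card_image_of_injective _ (enum_strictMono T).injective]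
  rw [disjoint_left]
  intro p hp hp'
  obtain ⟨q, -, rfl⟩ := mem_image.1 hp'
  exact enum_notMem T q (mem_filter.1 hp).1

end

/-! ### Counting partitions with symmetric blocks at the ends of the sectors -/

theorem finite_setoid (α : Type*) [Finite α] : Finite (Setoid α) :=
  Finite.of_injective (fun s : Setoid α => (s : α → α → Prop)) fun _ _ h =>
    Setoid.ext fun x y => iff_of_eq (congrFun (congrFun h x) y)

noncomputable instance setoidFintype (α : Type*) [Finite α] : Fintype (Setoid α) :=
  @Fintype.ofFinite _ (finite_setoid α)

/-- The blocks of `s` that contain no point at a position in `U` have `d` points. -/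
def OtherBlocks {M : ℕ} (d : ℕ) (s : Setoid (ZMod 2 × Fin M)) (U : Finset ℕ) : Prop :=
  ∀ x, (x.2 : ℕ) ∉ U → {y | s x y}.ncard = d

/-- The two first points lie in a common block, which occupies `c` positions of each sector; the
other blocks have `d` points. -/
def IsFront {M : ℕ} (d c : ℕ) (s : Setoid (ZMod 2 × Fin M)) : Prop :=
  SwapInv s ∧ Axial s 0 ∧ #(blk s 0) = c ∧ OtherBlocks d s (blk s 0)

/-- The two first points lie in a common block, and so do the two last points; these blocks are
different and occupy `c` positions of each sector each; the other blocks have `d` points. -/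
def IsDouble {M : ℕ} (d c : ℕ) (s : Setoid (ZMod 2 × Fin (M + 1))) : Prop :=
  SwapInv s ∧ (Axial s 0 ∧ #(blk s 0) = c) ∧ (Axial s M ∧ #(blk s M) = c) ∧ M ∉ blk s 0 ∧
    OtherBlocks d s (blk s 0 ∪ blk s M)

open Classical in
/-- The `2`-linear diagrams with `w` points in each sector. -/
noncomputable def linSet (d w : ℕ) : Finset (Setoid (ZMod 2 × Fin w)) :=
  {s | IsMultilinear 2 d w s}

open Classical in
/-- The symmetric partitions with a symmetric block at the beginning of the sectors, which occupies
`c` of the `M` positions of each sector. -/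
noncomputable def frontSet (d c M : ℕ) : Finset (Setoid (ZMod 2 × Fin M)) :=
  {s | IsFront d c s}

open Classical in
/-- The symmetric partitions with two different symmetric blocks, one at each end of the sectors of
`M + 1` points, which occupy `c` positions of each sector each. -/
noncomputable def doubleSet (d c M : ℕ) : Finset (Setoid (ZMod 2 × Fin (M + 1))) :=
  {s | IsDouble d c s}

theorem mem_linSet {d w : ℕ} {s : Setoid (ZMod 2 × Fin w)} :
    s ∈ linSet d w ↔ IsDiagram d s ∧ SwapInv s := by
  classical
  exact mem_filter_univ _

theorem mem_frontSet {d c M : ℕ} {s : Setoid (ZMod 2 × Fin M)} :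
    s ∈ frontSet d c M ↔ IsFront d c s := by
  classical
  exact mem_filter_univ _

theorem mem_doubleSet {d c M : ℕ} {s : Setoid (ZMod 2 × Fin (M + 1))} :
    s ∈ doubleSet d c M ↔ IsDouble d c s := by
  classical
  exact mem_filter_univ _

theorem sectorLoops_eq {w : ℕ} {s : Setoid (ZMod 2 × Fin w)} (hs : SwapInv s) (i : ZMod 2) :
    sectorLoops s i = #(loopSet s) := by
  have h0 : sectorLoops s i = sectorLoops s 0 := by
    rcases zmod_two_cases i with rfl | rfl
    · rfl
    · unfold sectorLoops
      congr 1
      ext p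
      exact exists_congr fun h => (hs.zero_zero _ _).symm
  rw [h0, sectorLoops, ← Set.ncard_image_of_injective _ Fin.val_injective, ← Set.ncard_coe_finset]
  congr 1
  ext p
  rw [mem_coe, mem_loopSet]
  constructor
  · rintro ⟨q, ⟨h, hq⟩, rfl⟩
    exact ⟨q.2, h, hq⟩
  · rintro ⟨hp, h, hq⟩
    exact ⟨⟨p, hp⟩, ⟨h, hq⟩, rfl⟩

theorem numLinear_eq (d w k : ℕ) : numLinear 2 d w k = #{s ∈ linSet d w | #(loopSet s) = k} := by
  refine Nat.subtype_card _ fun s => ?_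
  rw [mem_filter, mem_linSet]
  constructor
  · rintro ⟨h, rfl⟩
    exact ⟨h, fun i => sectorLoops_eq h.2 i⟩
  · rintro ⟨h, hk⟩
    exact ⟨h, (sectorLoops_eq h.2 0).symm.trans (hk 0)⟩

/-- Sorting the `2`-linear diagrams by their number of loops. -/
theorem sum_linSet (d w K : ℕ) (F : ℕ → ℤ) (hF : ∀ k, K ≤ k → F k = 0) :
    ∑ s ∈ linSet d w, F #(loopSet s) = ∑ k ∈ range K, F k * numLinear 2 d w k := by
  have h1 : ∑ s ∈ linSet d w, F #(loopSet s) =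
      ∑ s ∈ linSet d w with #(loopSet s) < K, F #(loopSet s) := by
    rw [sum_filter]
    refine sum_congr rfl fun s _ => ?_
    split_ifs with h
    · rfl
    · exact hF _ (by omega)
  rw [h1, ← sum_fiberwise_of_maps_to (t := range K) (g := fun s => #(loopSet s))
    (fun s hs => mem_range.2 (mem_filter.1 hs).2)]
  refine sum_congr rfl fun k hk => ?_
  rw [sum_congr rfl (g := fun _ => F k) (fun s hs => by rw [(mem_filter.1 hs).2]), sum_const,
    nsmul_eq_mul, mul_comm, numLinear_eq, filter_filter]
  congr 3
  refine filter_congr fun s _ => ?_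
  have := mem_range.1 hk
  omega

section
variable {w M d : ℕ} {T : Finset ℕ} {s : Setoid (ZMod 2 × Fin (M + 1))}

theorem otherBlocks_union_iff (hT : T ⊆ range (M + 1)) (hM : w + #T = M + 1) (hs : IsBlock s T)
    (U : Finset ℕ) : OtherBlocks d s (U ∪ T) ↔ ∀ y : ZMod 2 × Fin w, enum T y.2 ∉ U →
      {z | s.comap (embed M T) y z}.ncard = d := by
  constructor
  · intro h y hy
    rw [← ncard_class_embed hT hM hs]
    refine h _ ?_
    rw [mem_union, not_or, embed_val hT hM]
    exact ⟨hy, enum_notMem T _⟩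
  · intro h x hx
    rw [mem_union, not_or] at hx
    obtain ⟨y, rfl⟩ := exists_embed_eq hT hM hx.2
    rw [embed_val hT hM] at hx
    rw [ncard_class_embed hT hM hs]
    exact h y hx.1

/-- Removing the block of the first points leaves a `2`-linear diagram. -/
theorem isFront_iff_comap (hT : T ⊆ range (M + 1)) (hM : w + #T = M + 1) (h0 : 0 ∈ T)
    (hsw : SwapInv s) (hs : IsBlock s T) :
    IsFront d #T s ↔ s.comap (embed M T) ∈ linSet d w := by
  have hb := hs.blk_eq hT h0
  have hu := otherBlocks_union_iff (d := d) hT hM hs ∅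
  rw [empty_union] at hu
  rw [mem_linSet, IsFront, hb, hu]
  exact ⟨fun h => ⟨fun y => h.2.2.2 y (notMem_empty _), hsw.comap_embed⟩,
    fun h => ⟨hsw, hs.axial h0 (by omega), rfl, fun y _ => h.1 y⟩⟩

/-- Removing the block of the last points does not affect the block of the first ones. -/
theorem isDouble_iff_comap {c : ℕ} (hT : T ⊆ range (M + 1)) (hM : w + #T = M + 1) (h0 : 0 ∉ T)
    (hl : M ∈ T) (hsw : SwapInv s) (hs : IsBlock s T) :
    IsDouble d c s ↔ #T = c ∧ s.comap (embed M T) ∈ frontSet d c w := by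
  have hb := hs.blk_eq hT hl
  have hM0 : M ≠ 0 := fun h => h0 (h ▸ hl)
  have hE0 : enum T 0 = 0 := enum_zero h0
  have hw : 0 < w := (enum_lt_iff hT hM 0).1 (by omega)
  have hax : Axial s 0 ↔ Axial (s.comap (embed (w := w) M T)) 0 := by
    have he : ∀ i, embed M T (i, ⟨0, hw⟩) = (i, ⟨0, by omega⟩) := fun i => by
      rw [embed_mk hT hM]
      simp only [hE0]
    constructor
    · rintro ⟨_, h⟩
      refine ⟨hw, ?_⟩
      rw [Setoid.comap_rel, he, he]
      exact h
    · rintro ⟨_, h⟩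
      rw [Setoid.comap_rel, he, he] at h
      exact ⟨_, h⟩
  have hmem : ∀ q < w, q ∈ blk (s.comap (embed (w := w) M T)) 0 ↔ enum T q ∈ blk s 0 := by
    intro q hq
    rw [mem_blk, mem_blk]
    have h1 := (enum_lt_iff hT hM q).2 hq
    constructor
    · rintro ⟨_, _, h⟩
      rw [Setoid.comap_rel, embed_mk hT hM, embed_mk hT hM] at h
      simp only [hE0] at h
      exact ⟨_, h1, h⟩
    · rintro ⟨_, _, h⟩
      refine ⟨hw, hq, ?_⟩
      rw [Setoid.comap_rel, embed_mk hT hM, embed_mk hT hM]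
      simp only [hE0]
      exact h
  have hblk : blk s 0 = (blk (s.comap (embed (w := w) M T)) 0).image (enum T) := by
    ext p
    rw [mem_image]
    constructor
    · intro hp
      have hpT : p ∉ T := by
        obtain ⟨h1, h2, h3⟩ := mem_blk.1 hp
        exact fun h => hs.not_rel (x := (0, ⟨p, h2⟩)) h h0 h3
      obtain ⟨q, rfl⟩ := exists_enum_eq hpT
      exact ⟨q, (hmem q ((enum_lt_iff hT hM q).1 (mem_range.1 (blk_subset _ hp)))).2 hp, rfl⟩
    · rintro ⟨q, hq, rfl⟩
      exact (hmem q (mem_range.1 (blk_subset _ hq))).1 hq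
  have hcard : #(blk s 0) = #(blk (s.comap (embed (w := w) M T)) 0) := by
    rw [hblk, card_image_of_injective _ (enum_strictMono T).injective]
  have hMb : M ∉ blk s 0 := by
    intro h
    obtain ⟨h1, h2, h3⟩ := mem_blk.1 h
    exact hs.not_rel (x := (0, ⟨M, h2⟩)) hl h0 h3
  have hother : OtherBlocks d s (blk s 0 ∪ T) ↔
      OtherBlocks d (s.comap (embed (w := w) M T)) (blk (s.comap (embed (w := w) M T)) 0) := by
    rw [otherBlocks_union_iff hT hM hs]
    exact forall_congr' fun y => by rw [hmem _ y.2.2]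
  rw [mem_frontSet, IsDouble, IsFront, hb, hax, hcard, hother]
  exact ⟨fun ⟨_, h2, h3, _, h5⟩ => ⟨h3.2, hsw.comap_embed, h2.1, h2.2, h5⟩,
    fun ⟨h1, _, h3, h4, h5⟩ => ⟨hsw, ⟨h3, h4⟩, ⟨hs.axial hl (by omega), h1⟩, hMb, h5⟩⟩

end

/-- Summing a function of the number of loops and of the block of the first points: the diagram
that remains after the removal of this block is arbitrary, and so is the set `D` of gaps that the
block occupies; among the `m` further positions of the block in each sector there are `m - #D`
which directly follow another one. -/
theorem sum_frontSet (d w m : ℕ) (W : ℕ → Prop → ℤ) :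
    ∑ s ∈ frontSet d (m + 1) (w + m + 1), W #(loopSet s) (w + m ∈ blk s 0) =
      ∑ s' ∈ linSet d w, ∑ D ∈ (range w).powerset,
        (m.choose #D : ℤ) * W (m - #D + #(loopSet s' \ D)) (w = 0 ∨ w - 1 ∈ D) := by
  set 𝒯 : Finset (Finset ℕ) := {T ∈ powersetCard (m + 1) (range (w + m + 1)) | range 1 ⊆ T}
  have h𝒯 : ∀ T ∈ 𝒯, T ⊆ range (w + m + 1) ∧ #T = m + 1 ∧ 0 ∈ T := by
    intro T hT
    obtain ⟨h1, h2⟩ := mem_filter.1 hT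
    rw [mem_powersetCard] at h1
    exact ⟨h1.1, h1.2, h2 (by simp)⟩
  rw [sum_removeBlock (w := w) (M := w + m) (c := m + 1) (p := 0) (by omega) _ (linSet d w) 𝒯 h𝒯
    (W' := fun T s' => W (m - #(gapSet T w) + #(loopSet s' \ gapSet T w))
      (w = 0 ∨ w - 1 ∈ gapSet T w))]
  · refine sum_congr rfl fun s' _ => ?_
    exact sum_placements 1 w m (fun D => W (m - #D + #(loopSet s' \ D)) (w = 0 ∨ w - 1 ∈ D))
  · intro s hs
    obtain ⟨h1, h2, h3, h4⟩ := mem_frontSet.1 hs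
    refine ⟨h1, h2, mem_filter.2 ⟨mem_powersetCard.2 ⟨blk_subset 0, h3⟩, ?_⟩⟩
    rw [range_one, singleton_subset_iff]
    exact self_mem_blk (by omega)
  · exact fun s' hs' => (mem_linSet.1 hs').2
  · intro T hT s hs hsT
    obtain ⟨h1, h2, h3⟩ := h𝒯 T hT
    rw [mem_frontSet, ← h2]
    exact isFront_iff_comap h1 (by omega) h3 hs hsT
  · intro T hT s hs hsT
    obtain ⟨h1, h2, h3⟩ := h𝒯 T hT
    have h4 := card_adjSet_add (w := w) h1 (by omega)
    rw [if_pos h3] at h4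
    rw [card_loopSet (w := w) h1 (by omega) hsT, hsT.blk_eq h1 h3,
      show m - #(gapSet T w) = #(adjSet T) by omega]
    congr 1
    rw [eq_iff_iff]
    rcases Nat.eq_zero_or_pos w with rfl | hw
    · -- the block fills the sectors
      have : T = range (0 + m + 1) := eq_of_subset_of_card_le h1 (by simp [h2])
      simp [this]
    · obtain ⟨w, rfl⟩ : ∃ v, w = v + 1 := ⟨w - 1, by omega⟩
      rw [last_mem_iff (w := w) h1 (by omega)]
      simp

/-- The sets of occupied gaps for which no loop arises or remains. -/
theorem sum_powerset_loopless (w m : ℕ) (L : Finset ℕ) (Q : Finset ℕ → Prop) [DecidablePred Q] :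
    ∑ D ∈ (range w).powerset, (m.choose #D : ℤ) *
      (if m - #D + #(L \ D) = 0 ∧ Q D then 1 else 0) =
    #{D ∈ powersetCard m (range w) | L ⊆ D ∧ Q D} := by
  rw [card_eq_sum_ones, Nat.cast_sum, powersetCard_eq_filter, filter_filter, sum_filter]
  refine sum_congr rfl fun D _ => ?_
  simp only [Nat.add_eq_zero_iff, card_eq_zero, sdiff_eq_empty_iff_subset]
  rcases lt_trichotomy #D m with h | h | h
  · rw [if_neg (by omega), if_neg (by omega), mul_zero]
  · simp [h]
  · simp [Nat.choose_eq_zero_of_lt h, h.ne']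

/-- The number of loopless partitions in which a symmetric block contains the first and the last
points. -/
theorem card_frontSet_loopless_mem (d w m : ℕ) :
    (#{s ∈ frontSet d (m + 1) (w + 1 + m + 1) | loopSet s = ∅ ∧ w + 1 + m ∈ blk s 0} : ℤ) =
      ∑ s' ∈ linSet d (w + 1),
        binom ((w : ℤ) - #(loopSet s')) ((m : ℤ) - 1 - #(loopSet s')) := by
  classical
  have h := sum_frontSet d (w + 1) m (fun l P => if l = 0 ∧ P then 1 else 0)
  simp only [card_eq_zero] at h
  rw [card_filter, Nat.cast_sum]
  push_cast
  rw [h]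
  refine sum_congr rfl fun s' _ => ?_
  have hL : loopSet s' ⊆ range w := loopSet_subset
  have hw : w ∉ loopSet s' := fun h => by simpa using hL h
  have h2 := sum_powerset_loopless (w + 1) m (loopSet s') (fun D => w + 1 = 0 ∨ w + 1 - 1 ∈ D)
  refine Eq.trans (sum_congr rfl fun D _ => ?_) (h2.trans ?_)
  · congr 1
    congr
  have h3 := card_filter_superset (w := w + 1) (t := m) (A := insert w (loopSet s'))
    (insert_subset (by simp) (hL.trans (range_mono (by omega))))
  rw [card_insert_of_notMem hw] at h3
  convert h3 using 2
  · norm_cast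
    congr 1
    refine filter_congr fun D _ => ?_
    rw [insert_subset_iff, and_comm]
    simp
  · push_cast; ring
  · push_cast; ring

/-- The number of loopless partitions with a symmetric block that contains the first, but not the
last points. -/
theorem card_frontSet_loopless_notMem (d w m : ℕ) :
    (#{s ∈ frontSet d (m + 1) (w + 1 + m + 1) | loopSet s = ∅ ∧ w + 1 + m ∉ blk s 0} : ℤ) =
      ∑ s' ∈ linSet d (w + 1), binom ((w : ℤ) - #(loopSet s')) ((m : ℤ) - #(loopSet s')) := by
  classical
  have h := sum_frontSet d (w + 1) m (fun l P => if l = 0 ∧ ¬ P then 1 else 0)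
  simp only [card_eq_zero] at h
  rw [card_filter, Nat.cast_sum]
  push_cast
  rw [h]
  refine sum_congr rfl fun s' _ => ?_
  have hL : loopSet s' ⊆ range w := loopSet_subset
  have h2 := sum_powerset_loopless (w + 1) m (loopSet s') (fun D => ¬ (w + 1 = 0 ∨ w + 1 - 1 ∈ D))
  refine Eq.trans (sum_congr rfl fun D _ => ?_) (h2.trans ?_)
  · congr 1
    congr
  rw [← card_filter_superset hL]
  norm_cast
  congr 1
  ext D
  simp only [mem_filter, mem_powersetCard, false_or,
    Nat.add_sub_cancel]
  constructor
  · rintro ⟨⟨h1, h2⟩, h3, h4⟩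
    refine ⟨⟨fun x hx => ?_, h2⟩, h3⟩
    have := mem_range.1 (h1 hx)
    have : x ≠ w := fun h => h4 (h ▸ hx)
    exact mem_range.2 (by omega)
  · rintro ⟨⟨h1, h2⟩, h3⟩
    exact ⟨⟨h1.trans (range_mono (by omega)), h2⟩, h3, fun h => by simpa using h1 h⟩

/-- The number of ways to insert two different symmetric blocks, one at each end, into a
`2`-linear diagram with sectors of `w` points and with `k` loops in each sector, such that no loop
remains. Each block occupies `m` more positions in each sector. The block at the beginning is
inserted first; it creates `j` loops and destroys `s` of the `k` loops. -/
def doubleCoeff (w m k : ℕ) : ℤ :=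
  ∑ j ∈ range (m + 1), ∑ s ∈ range (min k (m - j) + 1),
    binom m j * binom k s * binom ((w : ℤ) - k) ((m : ℤ) - j - s) *
      binom ((w : ℤ) + m - (k + j - s)) ((m : ℤ) - (k + j - s))

theorem doubleCoeff_eq_zero {w m k : ℕ} (h : 2 * m + 1 ≤ k) : doubleCoeff w m k = 0 := by
  refine sum_eq_zero fun j hj => sum_eq_zero fun s hs => ?_
  have h1 := mem_range.1 hj
  have h2 := mem_range.1 hs
  rw [binom_eq_zero (a := (w : ℤ) + m - (k + j - s)) (by omega), mul_zero]

/-- Sorting the sets `D` of gaps by the number `j = m - #D` of loops that arise and by the number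
`s = #(L ∩ D)` of loops that are destroyed. -/
theorem sum_powerset_eq_doubleCoeff {w m : ℕ} {L : Finset ℕ} (hL : L ⊆ range w) :
    ∑ D ∈ (range w).powerset, (m.choose #D : ℤ) *
      binom ((w : ℤ) + m - (m - #D + #(L \ D) : ℕ)) ((m : ℤ) - (m - #D + #(L \ D) : ℕ)) =
    doubleCoeff w m #L := by
  have hLw : #L ≤ w := by simpa using card_le_card hL
  set g : Finset ℕ → ℤ := fun D => (m.choose #D : ℤ) *
    binom ((w : ℤ) + m - (m - #D + #(L \ D) : ℕ)) ((m : ℤ) - (m - #D + #(L \ D) : ℕ)) with hg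
  have h1 : ∑ D ∈ (range w).powerset, g D = ∑ D ∈ (range w).powerset with #D ≤ m, g D := by
    rw [sum_filter]
    refine sum_congr rfl fun D _ => ?_
    split_ifs with h
    · rfl
    · rw [hg]
      simp only
      rw [Nat.choose_eq_zero_of_lt (by omega), Nat.cast_zero, zero_mul]
  rw [h1, ← sum_fiberwise_of_maps_to (t := range (m + 1)) (g := fun D => m - #D)
    (fun D _ => mem_range.2 (by omega)), doubleCoeff]
  refine sum_congr rfl fun j hj => ?_
  have hjm := mem_range.1 hj
  have h2 : ({D ∈ (range w).powerset | #D ≤ m} : Finset (Finset ℕ)).filter (fun D => m - #D = j) =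
      powersetCard (m - j) (range w) := by
    rw [powersetCard_eq_filter, filter_filter]
    refine filter_congr fun D _ => ?_
    omega
  rw [h2, ← sum_fiberwise_of_maps_to (t := range (min #L (m - j) + 1)) (g := fun D => #(L ∩ D))]
  · refine sum_congr rfl fun s hs => ?_
    have hs' := mem_range.1 hs
    rw [sum_congr rfl (g := fun _ => (m.choose j : ℤ) *
      binom ((w : ℤ) + m - (#L + j - s)) ((m : ℤ) - (#L + j - s))), sum_const,
      card_filter_inter hL (by omega), binom_natCast', binom_natCast',
      binom_eq_choose (a := (w : ℤ) - #L) (a' := w - #L) (b' := m - j - s) (by omega) (by omega),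
      nsmul_eq_mul]
    · push_cast
      ring
    · intro D hD
      rw [mem_filter, mem_powersetCard] at hD
      have h3 := card_inter_add_card_sdiff L D
      have h4 : ((m - #D + #(L \ D) : ℕ) : ℤ) = #L + j - s := by omega
      rw [hg]
      simp only
      rw [h4, hD.1.2, Nat.choose_symm (by omega)]
  · intro D hD
    rw [mem_powersetCard] at hD
    have h3 := card_le_card (inter_subset_left : L ∩ D ⊆ L)
    have h4 := card_le_card (inter_subset_right : L ∩ D ⊆ D)
    exact mem_range.2 (by omega)

/-- The number of loopless partitions in which the first points lie in a symmetric block, and the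
last points lie in another one. -/
theorem card_doubleSet_loopless (d w m : ℕ) :
    (#{s ∈ doubleSet d (m + 1) (w + m + 1 + m) | loopSet s = ∅} : ℤ) =
      ∑ s' ∈ linSet d w, doubleCoeff w m #(loopSet s') := by
  classical
  set v := w + m + 1 with hv
  -- removing the block of the last points
  have key : (#{s ∈ doubleSet d (m + 1) (v + m) | loopSet s = ∅} : ℤ) =
      ∑ s' ∈ frontSet d (m + 1) v,
        binom ((w : ℤ) + m - #(loopSet s')) ((m : ℤ) - #(loopSet s')) := by
    set 𝒯 : Finset (Finset ℕ) :=
      {T ∈ powersetCard (m + 1) (range (v + m + 1)) | v + m ∈ T ∧ 0 ∉ T}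
    have h𝒯 : ∀ T ∈ 𝒯, (T ⊆ range (v + m + 1) ∧ #T = m + 1) ∧ v + m ∈ T ∧ 0 ∉ T := by
      intro T hT
      rwa [mem_filter, mem_powersetCard] at hT
    rw [card_filter, Nat.cast_sum]
    push_cast
    rw [sum_removeBlock (w := v) (M := v + m) (c := m + 1) (p := v + m) (by omega) _
      (frontSet d (m + 1) v) 𝒯 (fun T hT => ⟨(h𝒯 T hT).1.1, (h𝒯 T hT).1.2, (h𝒯 T hT).2.1⟩)
      (W' := fun T s' => if #(adjSet T) + #(loopSet s' \ gapSet T v) = 0 then 1 else 0)]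
    · -- No loop remains if and only if the gaps of all loops are occupied and no two positions of
      -- the block are consecutive, i.e. it occupies `m + 1` gaps. As it contains the last points,
      -- the last gap is one of them; as it does not contain the first ones, each of its positions
      -- lies in a gap.
      refine sum_congr rfl fun s' _ => ?_
      have hL : loopSet s' ⊆ range (w + m) := loopSet_subset
      have hw : w + m ∉ loopSet s' := fun h => by simpa using hL h
      have h1 := sum_placements (R := ℤ) 0 v (m + 1)
        (fun D => if #D = m + 1 ∧ insert (w + m) (loopSet s') ⊆ D then 1 else 0)
      have h2 : ∑ D ∈ (range v).powerset, (((m + 1).choose #D : ℕ) : ℤ) *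
          (if #D = m + 1 ∧ insert (w + m) (loopSet s') ⊆ D then 1 else 0) =
          #{D ∈ powersetCard (m + 1) (range v) | insert (w + m) (loopSet s') ⊆ D} := by
        rw [card_eq_sum_ones, Nat.cast_sum, powersetCard_eq_filter, filter_filter, sum_filter]
        refine sum_congr rfl fun D _ => ?_
        split_ifs with h
        · rw [h.1]
          simp
        · simp
      rw [h2, card_filter_superset
          (insert_subset (by simp [hv]) (hL.trans (range_mono (by omega)))),
        card_insert_of_notMem hw] at h1
      convert h1 using 1
      · simp only [sum_filter, 𝒯]
        refine sum_congr rfl fun T hT => ?_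
        obtain ⟨hT1, hT2⟩ := mem_powersetCard.1 hT
        have h3 := card_adjSet_add (w := v) hT1 (by omega)
        have h4 := last_mem_iff (w := w + m) (M := v + m) hT1 (by omega)
        rw [← ite_and, range_zero, if_pos (empty_subset _)]
        refine if_congr ?_ rfl rfl
        rw [h4, insert_subset_iff, Nat.add_eq_zero_iff, card_eq_zero (s := _ \ _),
          sdiff_eq_empty_iff_subset]
        have h5 : (#(adjSet T) = 0 ∧ 0 ∉ T) ↔ #(gapSet T v) = m + 1 := by
          split_ifs at h3 with h0
          · simp only [h0, not_true_eq_false, and_false, false_iff]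
            omega
          · simp only [h0, not_false_eq_true, and_true]
            omega
        rw [← h5]
        tauto
      · congr 1 <;> push_cast <;> omega
    · intro s hs
      obtain ⟨h1, h2, h3, h4, h5⟩ := mem_doubleSet.1 hs
      refine ⟨h1, h3.1, mem_filter.2 ⟨mem_powersetCard.2 ⟨blk_subset _, h3.2⟩,
        self_mem_blk (by omega), fun h0 => h4 ?_⟩⟩
      obtain ⟨h6, h7, h8⟩ := mem_blk.1 h0
      exact mem_blk.2 ⟨h7, h6, s.symm h8⟩
    · exact fun s' hs' => (mem_frontSet.1 hs').1
    · intro T hT s hs hsT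
      obtain ⟨⟨h1, h2⟩, h3, h4⟩ := h𝒯 T hT
      rw [mem_doubleSet, isDouble_iff_comap (w := v) h1 (by omega) h4 h3 hs hsT]
      exact and_iff_right h2
    · intro T hT s hs hsT
      obtain ⟨⟨h1, h2⟩, h3, h4⟩ := h𝒯 T hT
      refine if_congr ?_ rfl rfl
      rw [← card_eq_zero, card_loopSet (w := v) h1 (by omega) hsT]
  rw [key]
  have h := sum_frontSet d w m
    (fun l _ => binom ((w : ℤ) + m - l) ((m : ℤ) - l))
  rw [h]
  refine sum_congr rfl fun s' _ => ?_
  exact sum_powerset_eq_doubleCoeff (loopSet_subset.trans (range_mono (by omega)))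

/-! ### Folding a symmetric diagram along its axis -/

/-- The loopless diagrams on a circle of `N` points that are symmetric under `x ↦ -a - x`. -/
def IsReflected {N : ℕ} (d : ℕ) (a : ZMod N) (s : Setoid (ZMod N)) : Prop :=
  (IsDiagram d s ∧ ∀ x, x ≠ x + 1 → ¬ s x (x + 1)) ∧ ∀ x y, s x y ↔ s (-a - x) (-a - y)

theorem numFixed_sr (d n : ℕ) (a : ZMod (d * n)) :
    numFixed d n (DihedralGroup.sr a) = Nat.card {s // IsReflected d a s} := by
  refine Nat.card_congr ((Equiv.subtypeSubtypeEquivSubtypeInter _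
    (fun s : Setoid (ZMod (d * n)) => ∀ x y, s x y ↔ s (-a - x) (-a - y))).symm.trans
    (Equiv.subtypeEquivRight fun D => ?_)).symm
  have hsymm : ∀ x, (dihedralPerm (d * n) (DihedralGroup.sr a)).symm x = -a - x := by
    intro x
    rw [Equiv.symm_apply_eq]
    change x = -a - (-a - x)
    ring
  refine Iff.trans ?_ (Subtype.ext_iff.trans (eq_comm.trans Setoid.ext_iff)).symm
  refine forall_congr' fun x => forall_congr' fun y => ?_
  rw [← hsymm, ← hsymm]
  rfl

/-- The folding map: two sectors of `M` points cover the circle. Sector `0` consists of the points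
`0, …, M - 1`, and sector `1` of their mirror images, so that the points on the axis are covered
twice. -/
def fold (N a M : ℕ) (x : ZMod 2 × Fin M) : ZMod N :=
  if x.1 = 0 then (x.2 : ℕ) else -(a : ZMod N) - (x.2 : ℕ)

/-- The possible shapes of the axis of `x ↦ -a - x`: it passes between two points at both ends
(`a = 1`), through a point at one end (`a = 0`, `N` odd), or through points at both ends. -/
def FoldShape (N a M : ℕ) : Prop :=
  2 ≤ N ∧ ((a ≤ 1 ∧ N + 1 = 2 * M + a) ∨ (a = 0 ∧ N + 2 = 2 * M))

section
variable {N a M : ℕ}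

theorem fold_zero (p : Fin M) : fold N a M (0, p) = ((p : ℕ) : ZMod N) := rfl

theorem fold_one (p : Fin M) : fold N a M (1, p) = -(a : ZMod N) - ((p : ℕ) : ZMod N) := rfl

theorem fold_add_one (x : ZMod 2 × Fin M) :
    fold N a M (x.1 + 1, x.2) = -(a : ZMod N) - fold N a M x := by
  obtain ⟨i, p⟩ := x
  rcases zmod_two_cases i with rfl | rfl
  · rfl
  · rw [fold_one, show ((1 : ZMod 2) + 1) = 0 from rfl, fold_zero]
    ring

theorem dvd_iff_reflect_eq {p q : ℕ} :
    N ∣ p + q + a ↔ (p : ZMod N) = -(a : ZMod N) - (q : ZMod N) := by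
  rw [← ZMod.natCast_eq_zero_iff]
  push_cast
  constructor
  · intro h
    linear_combination h
  · intro h
    linear_combination h

theorem natCast_inj_of_lt {p q : ℕ} (hp : p < N) (hq : q < N)
    (h : (p : ZMod N) = (q : ZMod N)) : p = q := by
  rw [ZMod.natCast_eq_natCast_iff'] at h
  rwa [Nat.mod_eq_of_lt hp, Nat.mod_eq_of_lt hq] at h

theorem FoldShape.eq_of_dvd (h : FoldShape N a M) {p q : ℕ} (hp : p < M) (hq : q < M)
    (hd : N ∣ p + q + a) : p = q := by
  obtain ⟨h2, h⟩ := h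
  obtain ⟨c, hc⟩ := hd
  rcases Nat.eq_zero_or_pos c with rfl | hc0
  · omega
  · have : N * 1 ≤ N * c := Nat.mul_le_mul_left _ hc0
    omega

/-- The points of sector `1` that lie on the axis. -/
def axisCopies (N a M : ℕ) : Set (ZMod 2 × Fin M) := {z | z.1 = 1 ∧ N ∣ (z.2 : ℕ) + z.2 + a}

theorem FoldShape.eq_or_of_fold_eq (h : FoldShape N a M) {x y : ZMod 2 × Fin M}
    (hxy : fold N a M x = fold N a M y) :
    x = y ∨ (x.2 = y.2 ∧ N ∣ (x.2 : ℕ) + x.2 + a) := by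
  have hMN : M ≤ N := by
    have := h.1
    rcases h.2 with h | h <;> omega
  obtain ⟨i, p⟩ := x
  obtain ⟨j, q⟩ := y
  have hp := p.2
  have hq := q.2
  rcases zmod_two_cases i with rfl | rfl <;> rcases zmod_two_cases j with rfl | rfl
  · rw [fold_zero, fold_zero] at hxy
    exact Or.inl (Prod.ext rfl (Fin.ext (natCast_inj_of_lt (by omega) (by omega) hxy)))
  · rw [fold_zero, fold_one] at hxy
    have hd := dvd_iff_reflect_eq.2 hxy
    have := h.eq_of_dvd hp hq hd
    refine Or.inr ⟨Fin.ext this, ?_⟩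
    rw [← this] at hd
    exact hd
  · rw [fold_zero, fold_one] at hxy
    have hd := dvd_iff_reflect_eq.2 hxy.symm
    have := h.eq_of_dvd hq hp hd
    refine Or.inr ⟨Fin.ext this.symm, ?_⟩
    rw [this] at hd
    exact hd
  · rw [fold_one, fold_one] at hxy
    exact Or.inl (Prod.ext rfl (Fin.ext
      (natCast_inj_of_lt (by omega) (by omega) (sub_right_injective hxy))))

theorem FoldShape.injOn (h : FoldShape N a M) : Set.InjOn (fold N a M) (axisCopies N a M)ᶜ := by
  intro x hx y hy hxy
  rcases h.eq_or_of_fold_eq hxy with h1 | ⟨h1, h2⟩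
  · exact h1
  · refine Prod.ext ?_ h1
    have hx1 : x.1 = 0 := (zmod_two_cases x.1).resolve_right fun h3 => hx ⟨h3, h2⟩
    have hy1 : y.1 = 0 := (zmod_two_cases y.1).resolve_right fun h3 => hy ⟨h3, h1 ▸ h2⟩
    rw [hx1, hy1]

theorem FoldShape.exists_fold_eq (h : FoldShape N a M) (z : ZMod N) :
    ∃ x, x ∉ axisCopies N a M ∧ fold N a M x = z := by
  have h2 := h.1
  have : NeZero N := ⟨by omega⟩
  have hz := z.val_lt
  by_cases hzM : z.val < M
  · refine ⟨(0, ⟨z.val, hzM⟩), fun h => zero_ne_one h.1, ?_⟩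
    rw [fold_zero]
    exact ZMod.natCast_zmod_val z
  · have hp : N - a - z.val < M := by
      rcases h.2 with h | h <;> omega
    have hfold : fold N a M (1, ⟨N - a - z.val, hp⟩) = z := by
      rw [fold_one, eq_comm]
      conv_lhs => rw [← ZMod.natCast_zmod_val z]
      rw [← dvd_iff_reflect_eq]
      refine ⟨1, ?_⟩
      change z.val + (N - a - z.val) + a = N * 1
      rcases h.2 with h | h <;> omega
    refine ⟨_, fun hax => hzM ?_, hfold⟩
    have h3 : fold N a M (0, ⟨N - a - z.val, hp⟩) = z := by
      refine Eq.trans ?_ hfold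
      rw [fold_zero, fold_one]
      exact dvd_iff_reflect_eq.1 hax.2
    have h4 : N - a - z.val = z.val := by
      refine natCast_inj_of_lt (N := N) ?_ hz ?_
      · omega
      · rw [ZMod.natCast_zmod_val]
        exact h3
    omega

theorem FoldShape.surjective (h : FoldShape N a M) : Function.Surjective (fold N a M) := fun z =>
  let ⟨x, _, hx⟩ := h.exists_fold_eq z
  ⟨x, hx⟩

/-- The class of a copy of a point has as many elements more than the class of the point on the
circle as there are points of this class on the axis, which are covered twice. -/
theorem FoldShape.ncard_comap (h : FoldShape N a M) (s : Setoid (ZMod N)) (x : ZMod 2 × Fin M) :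
    {y | s (fold N a M x) y}.ncard + {z | z ∈ axisCopies N a M ∧ s.comap (fold N a M) x z}.ncard =
      {y | s.comap (fold N a M) x y}.ncard := by
  have h1 : {y | s (fold N a M x) y} =
      fold N a M '' ({y | s.comap (fold N a M) x y} \ axisCopies N a M) := by
    ext z
    constructor
    · intro hz
      obtain ⟨y, hy, rfl⟩ := h.exists_fold_eq z
      exact ⟨y, ⟨hz, hy⟩, rfl⟩
    · rintro ⟨y, hy, rfl⟩
      exact hy.1
  rw [h1, Set.InjOn.ncard_image (h.injOn.mono fun y hy => hy.2), add_comm,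
    ← Set.ncard_inter_add_ncard_sdiff_eq_ncard {y | s.comap (fold N a M) x y} (axisCopies N a M)]
  congr 2
  ext z
  exact and_comm

/-- On a circle, a symmetric diagram has a loop if and only if one of the sectors has a loop or
neighbouring points on the two sides of the axis are in a common block. -/
theorem FoldShape.loopless_iff (h : FoldShape N a M) {s : Setoid (ZMod N)}
    (hs : ∀ x y, s x y ↔ s (-a - x) (-a - y)) :
    (∀ x, x ≠ x + 1 → ¬ s x (x + 1)) ↔ loopSet (s.comap (fold N a M)) = ∅ ∧
      (a = 1 → ¬ Axial (s.comap (fold N a M)) 0) ∧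
      (N + 1 = 2 * M + a → ¬ Axial (s.comap (fold N a M)) (M - 1)) := by
  have h2 := h.1
  have : Fact (1 < N) := ⟨h2⟩
  have hne : ∀ x : ZMod N, x ≠ x + 1 := fun x hx => by simp at hx
  constructor
  · intro hl
    refine ⟨?_, ?_, ?_⟩
    · rw [eq_empty_iff_forall_notMem]
      intro p hp
      obtain ⟨h3, h4, h5⟩ := mem_loopSet.1 hp
      refine hl _ (hne p) ?_
      rw [Setoid.comap_rel, fold_zero, fold_zero] at h5
      push_cast at h5
      exact h5
    · rintro rfl ⟨h3, h4⟩
      refine hl (-1) (hne _) ?_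
      rw [Setoid.comap_rel, fold_zero, fold_one] at h4
      simpa using s.symm h4
    · rintro hN ⟨h3, h4⟩
      refine hl ((M - 1 : ℕ) : ZMod N) (hne _) ?_
      rw [Setoid.comap_rel, fold_zero, fold_one] at h4
      convert h4 using 1
      rw [← Nat.cast_succ, ← dvd_iff_reflect_eq]
      exact ⟨1, by change (M - 1) + 1 + (M - 1) + a = N * 1; omega⟩
  · rintro ⟨hL, h0, h1⟩ z - hz
    have : NeZero N := ⟨by omega⟩
    have hzN := z.val_lt
    -- neighbouring points of sector `0` and of sector `1`
    have hA : ∀ p : ℕ, p + 1 < M → ¬ s (p : ZMod N) ((p : ZMod N) + 1) := by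
      intro p hp hsp
      have : p ∈ loopSet (s.comap (fold N a M)) := by
        refine mem_loopSet.2 ⟨by omega, hp, ?_⟩
        rw [Setoid.comap_rel, fold_zero, fold_zero]
        push_cast
        exact hsp
      rw [hL] at this
      simp at this
    have hB : ∀ p : ℕ, p + 1 < M → z + (p + 1 : ℕ) + a = 0 → False := by
      intro p hp hzp
      refine hA p hp (s.symm ?_)
      rw [hs] at hz
      convert hz using 1
      · push_cast at hzp
        linear_combination hzp
      · push_cast at hzp
        linear_combination hzp
    have hzero : ∀ k : ℕ, z.val + k = N → z + (k : ZMod N) = 0 := by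
      intro k hk
      conv_lhs => rw [← ZMod.natCast_zmod_val z]
      rw [← Nat.cast_add, hk, ZMod.natCast_self]
    rcases lt_trichotomy (z.val + 1) M with hzM | hzM | hzM
    · refine hA z.val hzM ?_
      rw [ZMod.natCast_zmod_val]
      exact hz
    · rcases h.2 with ⟨ha, hN⟩ | ⟨rfl, hN⟩
      · refine h1 hN ⟨by omega, ?_⟩
        rw [Setoid.comap_rel, fold_zero, fold_one]
        have e1 : ((M - 1 : ℕ) : ZMod N) = z := by
          rw [show M - 1 = z.val by omega, ZMod.natCast_zmod_val]
        have e2 : z + ((M + a : ℕ) : ZMod N) = 0 := hzero _ (by omega)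
        simp only [e1]
        convert hz using 1
        have e3 : ((M : ℕ) : ZMod N) = z + 1 := by
          rw [← e1, ← Nat.cast_succ]
          congr 1
          omega
        push_cast at e2
        rw [e3] at e2
        linear_combination -e2
      · refine hB (M - 2) (by omega) ?_
        rw [show M - 2 + 1 = M - 1 by omega, hzero (M - 1) (by omega)]
        simp
    · rcases Nat.lt_or_ge (z.val + a) N with hza | hza
      · refine hB (N - a - z.val - 1) ?_ ?_
        · rcases h.2 with h | h <;> omega
        · rw [add_assoc, ← Nat.cast_add]
          exact hzero _ (by omega)
      · have ha : a = 1 := by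
          rcases h.2 with h | h <;> omega
        subst ha
        refine h0 rfl ⟨by rcases h.2 with h | h <;> omega, ?_⟩
        rw [Setoid.comap_rel, fold_zero, fold_one]
        have e1 := hzero 1 (by omega)
        push_cast at e1 ⊢
        rw [show -(1 : ZMod N) - 0 = z by linear_combination -e1]
        rw [e1] at hz
        exact s.symm hz

/-- The folded form of the symmetric loopless diagrams: the two copies of a point on the axis are
equivalent, a block has `d` points if these copies are counted once, and there are neither loops in
the sectors nor loops across an end of the axis that lies between two points. -/
def IsFolded (N a M d : ℕ) (t : Setoid (ZMod 2 × Fin M)) : Prop :=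
  SwapInv t ∧ (∀ p < M, N ∣ p + p + a → Axial t p) ∧
    (∀ x, d + {z | z ∈ axisCopies N a M ∧ t x z}.ncard = {y | t x y}.ncard) ∧
    loopSet t = ∅ ∧ (a = 1 → ¬ Axial t 0) ∧ (N + 1 = 2 * M + a → ¬ Axial t (M - 1))

/-- Folding is a bijection from the symmetric loopless diagrams onto their folded forms. -/
theorem FoldShape.card_isReflected (h : FoldShape N a M) (d : ℕ) :
    Nat.card {s : Setoid (ZMod N) // IsReflected d (a : ZMod N) s} =
      Nat.card {t // IsFolded N a M d t} := by
  have key : ∀ s : Setoid (ZMod N), IsReflected d (a : ZMod N) s ↔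
      IsFolded N a M d (s.comap (fold N a M)) := by
    intro s
    have hsw : (∀ x y, s x y ↔ s (-a - x) (-a - y)) ↔ SwapInv (s.comap (fold N a M)) := by
      constructor
      · intro hs x y
        change s (fold N a M x) (fold N a M y) ↔
          s (fold N a M (x.1 + 1, x.2)) (fold N a M (y.1 + 1, y.2))
        rw [fold_add_one, fold_add_one]
        exact hs _ _
      · intro hs x y
        obtain ⟨x, rfl⟩ := h.surjective x
        obtain ⟨y, rfl⟩ := h.surjective y
        have : s (fold N a M x) (fold N a M y) ↔
            s (fold N a M (x.1 + 1, x.2)) (fold N a M (y.1 + 1, y.2)) := hs x y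
        rwa [fold_add_one, fold_add_one] at this
    have hax : ∀ p < M, N ∣ p + p + a → Axial (s.comap (fold N a M)) p := by
      intro p hp hd
      refine ⟨hp, ?_⟩
      rw [Setoid.comap_rel, fold_zero, fold_one, ← dvd_iff_reflect_eq.1 hd]
    have hdia : IsDiagram d s ↔ ∀ x, d + {z | z ∈ axisCopies N a M ∧
        s.comap (fold N a M) x z}.ncard = {y | s.comap (fold N a M) x y}.ncard := by
      constructor
      · intro hd x
        rw [← h.ncard_comap, hd]
      · intro hd x
        obtain ⟨x, rfl⟩ := h.surjective x
        have := hd x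
        rw [← h.ncard_comap] at this
        exact (Nat.add_right_cancel this).symm
    constructor
    · rintro ⟨⟨h1, h2⟩, h3⟩
      exact ⟨hsw.1 h3, hax, hdia.1 h1, (h.loopless_iff h3).1 h2⟩
    · rintro ⟨h1, -, h3, h4⟩
      exact ⟨⟨hdia.2 h3, (h.loopless_iff (hsw.2 h1)).2 h4⟩, hsw.2 h1⟩
  refine Nat.card_congr (Equiv.ofBijective
    (fun s => ⟨s.1.comap (fold N a M), (key s.1).1 s.2⟩) ⟨?_, ?_⟩)
  · intro s t hst
    refine Subtype.ext (Setoid.ext fun x y => ?_)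
    obtain ⟨x, rfl⟩ := h.surjective x
    obtain ⟨y, rfl⟩ := h.surjective y
    exact Setoid.ext_iff.1 (congrArg Subtype.val hst) x y
  · rintro ⟨t, ht⟩
    -- points with the same image are equivalent, so `t` descends to the circle
    have hker : ∀ x y, fold N a M x = fold N a M y → t x y := by
      rintro ⟨i, p⟩ ⟨j, q⟩ hxy
      rcases h.eq_or_of_fold_eq hxy with h1 | ⟨h1, h2⟩
      · rw [h1]
      · obtain ⟨h3, h4⟩ := ht.2.1 p p.2 h2
        obtain rfl : p = q := h1
        rcases zmod_two_cases i with rfl | rfl <;> rcases zmod_two_cases j with rfl | rfl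
        · exact t.refl _
        · exact h4
        · exact t.symm h4
        · exact t.refl _
    have hcomap : (Setoid.ker fun z => (⟦(h.surjective z).choose⟧ : Quotient t)).comap
        (fold N a M) = t := by
      refine Setoid.ext fun x y => ?_
      rw [Setoid.comap_rel, Setoid.ker_def, Quotient.eq]
      have hx := hker _ _ (h.surjective (fold N a M x)).choose_spec
      have hy := hker _ _ (h.surjective (fold N a M y)).choose_spec
      exact ⟨fun h => t.trans (t.symm hx) (t.trans h hy),
        fun h => t.trans hx (t.trans h (t.symm hy))⟩
    refine ⟨⟨Setoid.ker fun z => (⟦(h.surjective z).choose⟧ : Quotient t), ?_⟩,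
      Subtype.ext hcomap⟩
    rw [key, hcomap]
    exact ht

end

/-! ### Symmetric diagrams by the position of the axis -/

section
variable {M : ℕ} {t : Setoid (ZMod 2 × Fin M)}

theorem Axial.rel_one_iff (ht : SwapInv t) {p : ℕ} (h : Axial t p) (hp : p < M)
    (x : ZMod 2 × Fin M) : t x (1, ⟨p, hp⟩) ↔ (x.2 : ℕ) ∈ blk t p := by
  rw [← h.isBlock ht (1, ⟨p, hp⟩) x (self_mem_blk hp)]
  exact ⟨t.symm, t.symm⟩

theorem Axial.ncard_class (ht : SwapInv t) {p : ℕ} (h : Axial t p) {x : ZMod 2 × Fin M}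
    (hx : (x.2 : ℕ) ∈ blk t p) : {y | t x y}.ncard = 2 * #(blk t p) :=
  KChord.ncard_class (blk_subset p) (h.isBlock ht) hx

theorem Axial.of_mem_blk (ht : SwapInv t) {p q : ℕ} (h : Axial t p) (hq : q ∈ blk t p) :
    Axial t q :=
  (h.isBlock ht).axial hq (mem_range.1 (blk_subset p hq))

theorem Axial.blk_eq_of_mem (ht : SwapInv t) {p q : ℕ} (h : Axial t p) (hq : q ∈ blk t p) :
    blk t q = blk t p :=
  (h.isBlock ht).blk_eq (blk_subset p) hq

open Classical in
theorem ncard_mem_singleton_and (b x : ZMod 2 × Fin M) :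
    {z | z ∈ ({b} : Set (ZMod 2 × Fin M)) ∧ t x z}.ncard = if t x b then 1 else 0 := by
  split_ifs with h
  · rw [Set.ncard_eq_one]
    refine ⟨b, ?_⟩
    ext z
    simp only [Set.mem_singleton_iff, Set.mem_ofPred_eq, and_iff_left_iff_imp]
    rintro rfl
    exact h
  · rw [Set.ncard_eq_zero]
    ext z
    simp only [Set.mem_singleton_iff, Set.mem_ofPred_eq, Set.mem_empty_iff_false, iff_false,
      not_and]
    rintro rfl
    exact h

open Classical in
theorem ncard_mem_pair_and {b c : ZMod 2 × Fin M} (hbc : b ≠ c) (x : ZMod 2 × Fin M) :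
    {z | z ∈ ({b, c} : Set (ZMod 2 × Fin M)) ∧ t x z}.ncard =
      (if t x b then 1 else 0) + if t x c then 1 else 0 := by
  rw [← ncard_mem_singleton_and, ← ncard_mem_singleton_and, ← Set.ncard_union_eq]
  · congr 1
    ext z
    simp only [Set.mem_insert_iff, Set.mem_singleton_iff, Set.mem_ofPred_eq, Set.mem_union]
    tauto
  · rw [Set.disjoint_left]
    rintro z ⟨h1, -⟩ ⟨h2, -⟩
    exact hbc (h1.symm.trans h2)

end

/-- No point lies on the axis. -/
theorem isFolded_no_point {N v d : ℕ} (hN : N = 2 * (v + 1)) (t : Setoid (ZMod 2 × Fin (v + 1))) :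
    IsFolded N 1 (v + 1) d t ↔
      t ∈ linSet d (v + 1) ∧ loopSet t = ∅ ∧ ¬ Axial t 0 ∧ ¬ Axial t v := by
  have hd : ∀ p, ¬ N ∣ p + p + 1 := by
    rintro p ⟨c, hc⟩
    rw [hN, mul_assoc] at hc
    omega
  have hZ : axisCopies N 1 (v + 1) = ∅ := by
    rw [Set.eq_empty_iff_forall_notMem]
    exact fun z hz => hd _ hz.2
  rw [mem_linSet, IsFolded, hZ]
  simp only [Set.mem_empty_iff_false, false_and, Set.ofPred_false, Set.ncard_empty, add_zero,
    forall_const, Nat.add_sub_cancel]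
  constructor
  · rintro ⟨h1, -, h3, h4, h5, h6⟩
    exact ⟨⟨fun x => (h3 x).symm, h1⟩, h4, h5, h6 (by omega)⟩
  · rintro ⟨⟨h3, h1⟩, h4, h5, h6⟩
    exact ⟨h1, fun p _ h => (hd p h).elim, fun x => (h3 x).symm, h4, h5, fun _ => h6⟩

/-- One point lies on the axis. The block of this point is the only symmetric one, because a
symmetric block without a point on the axis has an even number of points. -/
theorem isFolded_one_point {N v m : ℕ} (hv : 1 ≤ v) (hN : N = 2 * v + 1)
    (t : Setoid (ZMod 2 × Fin (v + 1))) :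
    IsFolded N 0 (v + 1) (2 * m + 1) t ↔
      t ∈ frontSet (2 * m + 1) (m + 1) (v + 1) ∧ loopSet t = ∅ ∧ v ∉ blk t 0 := by
  classical
  have hd : ∀ p < v + 1, N ∣ p + p + 0 → p = 0 := by
    rintro p hp ⟨c, hc⟩
    rcases Nat.eq_zero_or_pos c with rfl | hc0
    · omega
    · have : N * 1 ≤ N * c := Nat.mul_le_mul_left _ hc0
      omega
  have hZ : axisCopies N 0 (v + 1) = {(1, ⟨0, by omega⟩)} := by
    ext ⟨i, p⟩
    rw [Set.mem_singleton_iff]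
    constructor
    · rintro ⟨h1, h2⟩
      exact Prod.ext h1 (Fin.ext (hd p p.2 h2))
    · intro h
      obtain ⟨h1, h2⟩ := Prod.ext_iff.1 h
      refine ⟨h1, ?_⟩
      have h3 : (p : ℕ) = 0 := congrArg Fin.val h2
      change N ∣ (p : ℕ) + p + 0
      rw [h3]
      exact dvd_zero _
  have hsize : SwapInv t → Axial t 0 → ∀ x, {z | z ∈ axisCopies N 0 (v + 1) ∧ t x z}.ncard =
      if (x.2 : ℕ) ∈ blk t 0 then 1 else 0 := by
    intro ht hax x
    rw [hZ, ncard_mem_singleton_and]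
    exact if_congr (hax.rel_one_iff ht _ _) rfl rfl
  rw [mem_frontSet]
  constructor
  · rintro ⟨h1, h2, h3, h4, -, h6⟩
    have hax := h2 0 (by omega) (dvd_zero _)
    have hs := hsize h1 hax
    refine ⟨⟨h1, hax, ?_, fun x hx => ?_⟩, h4, fun h => h6 (by omega) (hax.of_mem_blk h1 h)⟩
    · have h7 := h3 (0, ⟨0, by omega⟩)
      have h8 := self_mem_blk (s := t) (p := 0) (by omega)
      rw [hs, if_pos h8, hax.ncard_class h1 h8] at h7
      omega
    · have h7 := h3 x
      rw [hs, if_neg hx] at h7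
      exact h7.symm
  · rintro ⟨⟨h1, hax, h2, h3⟩, h4, h5⟩
    have hs := hsize h1 hax
    refine ⟨h1, fun p hp h => ?_, fun x => ?_, h4, fun h => by omega, fun _ h => ?_⟩
    · rw [hd p hp h]
      exact hax
    · rw [hs]
      split_ifs with hx
      · rw [hax.ncard_class h1 hx, h2]
        ring
      · exact (h3 x hx).symm
    · rw [Nat.add_sub_cancel] at h
      have h7 := self_mem_blk (s := t) (p := v) (by omega)
      have h6 := h.ncard_class h1 (x := (0, ⟨v, by omega⟩)) h7
      rw [h3 _ h5] at h6
      omega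

/-- Two points lie on the axis. -/
theorem isFolded_two_points_iff {N v d : ℕ} (hN : N = 2 * v + 2)
    (t : Setoid (ZMod 2 × Fin (v + 2))) :
    IsFolded N 0 (v + 2) d t ↔ SwapInv t ∧ Axial t 0 ∧ Axial t (v + 1) ∧
      (∀ x, {y | t x y}.ncard = d + (if (x.2 : ℕ) ∈ blk t 0 then 1 else 0) +
        if (x.2 : ℕ) ∈ blk t (v + 1) then 1 else 0) ∧ loopSet t = ∅ := by
  classical
  have hd : ∀ p < v + 2, N ∣ p + p + 0 ↔ p = 0 ∨ p = v + 1 := by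
    intro p hp
    constructor
    · rintro ⟨c, hc⟩
      rcases Nat.lt_or_ge c 2 with hc2 | hc2
      · interval_cases c <;> omega
      · have : N * 2 ≤ N * c := Nat.mul_le_mul_left _ hc2
        omega
    · rintro (rfl | rfl)
      · exact dvd_zero _
      · exact ⟨1, by omega⟩
  have hZ : axisCopies N 0 (v + 2) = {(1, ⟨0, by omega⟩), (1, ⟨v + 1, by omega⟩)} := by
    ext ⟨i, p⟩
    rw [Set.mem_insert_iff, Set.mem_singleton_iff, Prod.ext_iff, Prod.ext_iff, Fin.ext_iff,
      Fin.ext_iff, ← and_or_left]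
    exact and_congr_right fun _ => hd p p.2
  have hsize : SwapInv t → Axial t 0 → Axial t (v + 1) → ∀ x,
      {z | z ∈ axisCopies N 0 (v + 2) ∧ t x z}.ncard =
      (if (x.2 : ℕ) ∈ blk t 0 then 1 else 0) + if (x.2 : ℕ) ∈ blk t (v + 1) then 1 else 0 := by
    intro ht h0 h1 x
    rw [hZ, ncard_mem_pair_and (by simp)]
    congr 1
    · exact if_congr (h0.rel_one_iff ht _ _) rfl rfl
    · exact if_congr (h1.rel_one_iff ht _ _) rfl rfl
  constructor
  · rintro ⟨h1, h2, h3, h4, -, -⟩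
    have h5 := h2 0 (by omega) ((hd 0 (by omega)).2 (Or.inl rfl))
    have h6 := h2 (v + 1) (by omega) ((hd (v + 1) (by omega)).2 (Or.inr rfl))
    refine ⟨h1, h5, h6, fun x => ?_, h4⟩
    rw [← h3, hsize h1 h5 h6, add_assoc]
  · rintro ⟨h1, h5, h6, h3, h4⟩
    refine ⟨h1, fun p hp h => ?_, fun x => ?_, h4, fun h => by omega, fun h => by omega⟩
    · rcases (hd p hp).1 h with rfl | rfl
      · exact h5
      · exact h6
    · rw [h3, hsize h1 h5 h6, add_assoc]

/-- If `d` is even, then the two points on the axis lie in the same block. -/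
theorem isFolded_two_points_even {N v e : ℕ} (hN : N = 2 * v + 2)
    (t : Setoid (ZMod 2 × Fin (v + 2))) :
    IsFolded N 0 (v + 2) (2 * e) t ↔
      t ∈ frontSet (2 * e) (e + 1) (v + 2) ∧ loopSet t = ∅ ∧ v + 1 ∈ blk t 0 := by
  rw [isFolded_two_points_iff hN, mem_frontSet]
  constructor
  · rintro ⟨h1, h2, h3, h4, h5⟩
    have h6 := self_mem_blk (s := t) (p := 0) (by omega)
    have h7 := h4 (0, ⟨0, by omega⟩)
    rw [h2.ncard_class h1 h6, if_pos h6] at h7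
    have h8 : 0 ∈ blk t (v + 1) := by
      by_contra h
      rw [if_neg h] at h7
      omega
    rw [if_pos h8] at h7
    have h9 := h3.blk_eq_of_mem h1 h8
    refine ⟨⟨h1, h2, by omega, fun x hx => ?_⟩, h5, ?_⟩
    · rw [h4 x, ← h9, if_neg hx, add_zero, add_zero]
    · rw [h9]
      exact self_mem_blk (by omega)
  · rintro ⟨⟨h1, h2, h3, h4⟩, h5, h6⟩
    have h7 := h2.blk_eq_of_mem h1 h6
    refine ⟨h1, h2, h2.of_mem_blk h1 h6, fun x => ?_, h5⟩
    rw [h7]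
    split_ifs with hx
    · rw [h2.ncard_class h1 hx, h3]
      ring
    · exact h4 x hx

/-- If `d` is odd, then the two points on the axis lie in different blocks. -/
theorem isFolded_two_points_odd {N v m : ℕ} (hN : N = 2 * v + 2)
    (t : Setoid (ZMod 2 × Fin (v + 2))) :
    IsFolded N 0 (v + 2) (2 * m + 1) t ↔
      t ∈ doubleSet (2 * m + 1) (m + 1) (v + 1) ∧ loopSet t = ∅ := by
  rw [isFolded_two_points_iff hN, mem_doubleSet]
  have hsymm : 0 ∈ blk t (v + 1) ↔ v + 1 ∈ blk t 0 := by
    rw [mem_blk, mem_blk]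
    exact ⟨fun ⟨h1, h2, h3⟩ => ⟨h2, h1, t.symm h3⟩, fun ⟨h1, h2, h3⟩ => ⟨h2, h1, t.symm h3⟩⟩
  constructor
  · rintro ⟨h1, h2, h3, h4, h5⟩
    have h6 := self_mem_blk (s := t) (p := 0) (by omega)
    have h6' := self_mem_blk (s := t) (p := v + 1) (by omega)
    have h7 := h4 (0, ⟨0, by omega⟩)
    have h7' := h4 (0, ⟨v + 1, by omega⟩)
    rw [h2.ncard_class h1 h6, if_pos h6] at h7
    rw [h3.ncard_class h1 h6', if_pos h6'] at h7'
    have h8 : v + 1 ∉ blk t 0 := by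
      intro h
      rw [if_pos (hsymm.2 h)] at h7
      omega
    rw [if_neg (fun h => h8 (hsymm.1 h))] at h7
    rw [if_neg h8] at h7'
    refine ⟨⟨h1, ⟨h2, by omega⟩, ⟨h3, by omega⟩, h8, fun x hx => ?_⟩, h5⟩
    rw [mem_union, not_or] at hx
    rw [h4 x, if_neg hx.1, if_neg hx.2]
  · rintro ⟨⟨h1, ⟨h2, h3⟩, ⟨h4, h5⟩, h6, h7⟩, h8⟩
    refine ⟨h1, h2, h4, fun x => ?_, h8⟩
    by_cases hx : (x.2 : ℕ) ∈ blk t 0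
    · have hx' : (x.2 : ℕ) ∉ blk t (v + 1) := by
        intro hx'
        have := (h4.blk_eq_of_mem h1 hx').symm.trans (h2.blk_eq_of_mem h1 hx)
        exact h6 (this ▸ self_mem_blk (by omega))
      rw [h2.ncard_class h1 hx, if_pos hx, if_neg hx', h3]
      ring
    · by_cases hx' : (x.2 : ℕ) ∈ blk t (v + 1)
      · rw [h4.ncard_class h1 hx', if_neg hx, if_pos hx', h5]
        ring
      · rw [if_neg hx, if_neg hx']
        refine h7 x ?_
        rw [mem_union, not_or]
        exact ⟨hx, hx'⟩

/-- A symmetric block without points on the axis has an even number of points. -/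
theorem not_axial_of_odd {M m : ℕ} {t : Setoid (ZMod 2 × Fin M)} (ht : t ∈ linSet (2 * m + 1) M)
    (p : ℕ) : ¬ Axial t p := by
  intro h
  obtain ⟨h1, h2⟩ := mem_linSet.1 ht
  have hp := h.1
  have h3 := h.ncard_class h2 (x := (0, ⟨p, hp⟩)) (self_mem_blk hp)
  rw [h1] at h3
  omega

/-- The order of the points is reversed in both sectors. -/
def revSetoid {M : ℕ} (t : Setoid (ZMod 2 × Fin M)) : Setoid (ZMod 2 × Fin M) :=
  t.comap fun x => (x.1, x.2.rev)

section
variable {M : ℕ} {t : Setoid (ZMod 2 × Fin M)}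

theorem revSetoid_revSetoid (t : Setoid (ZMod 2 × Fin M)) : revSetoid (revSetoid t) = t := by
  refine Setoid.ext fun x y => ?_
  change t (x.1, x.2.rev.rev) (y.1, y.2.rev.rev) ↔ t x y
  rw [Fin.rev_rev, Fin.rev_rev]

theorem revSetoid_mem_linSet {d : ℕ} (h : t ∈ linSet d M) : revSetoid t ∈ linSet d M := by
  rw [mem_linSet] at h ⊢
  refine ⟨?_, fun x y => h.2 (x.1, x.2.rev) (y.1, y.2.rev)⟩
  exact isDiagram_permSetoid ((Equiv.refl (ZMod 2)).prodCongr Fin.revPerm) h.1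

theorem loopSet_revSetoid_eq_empty (h : loopSet t = ∅) : loopSet (revSetoid t) = ∅ := by
  rw [eq_empty_iff_forall_notMem] at h ⊢
  intro p hp
  obtain ⟨h1, h2, h3⟩ := mem_loopSet.1 hp
  refine h (M - 2 - p) (mem_loopSet.2 ⟨by omega, by omega, t.symm ?_⟩)
  change t (0, Fin.rev ⟨p, h1⟩) (0, Fin.rev ⟨p + 1, h2⟩) at h3
  convert h3 using 3 <;> simp only [Fin.rev] <;> omega

theorem axial_revSetoid {p q : ℕ} (hpq : p + q + 1 = M) (h : Axial t p) :
    Axial (revSetoid t) q := by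
  obtain ⟨hp, h⟩ := h
  refine ⟨by omega, ?_⟩
  change t (0, Fin.rev ⟨q, _⟩) (1, Fin.rev ⟨q, _⟩)
  convert h using 3 <;> simp only [Fin.rev] <;> omega

end

open Classical in
/-- The loopless diagrams with a symmetric block at the end of the sectors are the mirror images of
those with a symmetric block at their beginning. -/
theorem card_axial_last (d v : ℕ) :
    #{t ∈ linSet d (v + 1) | loopSet t = ∅ ∧ Axial t v} =
      #{t ∈ linSet d (v + 1) | loopSet t = ∅ ∧ Axial t 0} := by
  refine card_bij' (fun t _ => revSetoid t) (fun t _ => revSetoid t) ?_ ?_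
    (fun t _ => revSetoid_revSetoid t) (fun t _ => revSetoid_revSetoid t)
  · intro t ht
    rw [mem_filter] at ht ⊢
    exact ⟨revSetoid_mem_linSet ht.1, loopSet_revSetoid_eq_empty ht.2.1,
      axial_revSetoid (by omega) ht.2.2⟩
  · intro t ht
    rw [mem_filter] at ht ⊢
    exact ⟨revSetoid_mem_linSet ht.1, loopSet_revSetoid_eq_empty ht.2.1,
      axial_revSetoid (by omega) ht.2.2⟩

theorem isFront_iff_axial {M e : ℕ} (t : Setoid (ZMod 2 × Fin M)) :
    t ∈ frontSet (2 * e) e M ↔ t ∈ linSet (2 * e) M ∧ Axial t 0 := by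
  rw [mem_frontSet, mem_linSet]
  constructor
  · rintro ⟨h1, h2, h3, h4⟩
    refine ⟨⟨fun x => ?_, h1⟩, h2⟩
    by_cases hx : (x.2 : ℕ) ∈ blk t 0
    · rw [h2.ncard_class h1 hx, h3]
    · exact h4 x hx
  · rintro ⟨⟨h1, h2⟩, h3⟩
    have h4 := h3.ncard_class h2 (x := (0, ⟨0, h3.1⟩)) (self_mem_blk h3.1)
    rw [h1] at h4
    exact ⟨h2, h3, by omega, fun x _ => h1 x⟩

theorem isDouble_iff_axial {v e : ℕ} (t : Setoid (ZMod 2 × Fin (v + 1))) :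
    t ∈ doubleSet (2 * e) e v ↔
      t ∈ linSet (2 * e) (v + 1) ∧ Axial t 0 ∧ Axial t v ∧ v ∉ blk t 0 := by
  rw [mem_doubleSet, mem_linSet]
  constructor
  · rintro ⟨h1, ⟨h2, h3⟩, ⟨h4, h5⟩, h6, h7⟩
    refine ⟨⟨fun x => ?_, h1⟩, h2, h4, h6⟩
    by_cases hx : (x.2 : ℕ) ∈ blk t 0
    · rw [h2.ncard_class h1 hx, h3]
    by_cases hx' : (x.2 : ℕ) ∈ blk t v
    · rw [h4.ncard_class h1 hx', h5]
    · refine h7 x ?_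
      rw [mem_union, not_or]
      exact ⟨hx, hx'⟩
  · rintro ⟨⟨h1, h2⟩, h3, h4, h5⟩
    have h6 := h3.ncard_class h2 (x := (0, ⟨0, h3.1⟩)) (self_mem_blk h3.1)
    have h7 := h4.ncard_class h2 (x := (0, ⟨v, h4.1⟩)) (self_mem_blk h4.1)
    rw [h1] at h6 h7
    exact ⟨h2, ⟨h3, by omega⟩, ⟨h4, by omega⟩, h5, fun x _ => h1 x⟩

open Classical in
/-- Inclusion and exclusion over the loops across the two ends of the axis. -/
theorem card_no_point_even (u m : ℕ) :
    (#{t ∈ linSet (2 * (m + 1)) (u + m + 1 + m + 1) |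
        loopSet t = ∅ ∧ ¬ Axial t 0 ∧ ¬ Axial t (u + m + 1 + m)} : ℤ) =
      numLinear 2 (2 * (m + 1)) (u + m + 1 + m + 1) 0
      - 2 * ∑ s' ∈ linSet (2 * (m + 1)) (u + m + 1),
          binom (((u + m : ℕ) : ℤ) - #(loopSet s')) ((m : ℤ) - #(loopSet s'))
      + ∑ s' ∈ linSet (2 * (m + 1)) u, doubleCoeff u m #(loopSet s')
      - ∑ s' ∈ linSet (2 * (m + 1)) (u + m + 1),
          binom (((u + m : ℕ) : ℤ) - #(loopSet s')) ((m : ℤ) - 1 - #(loopSet s')) := by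
  set d := 2 * (m + 1) with hd
  set v := u + m + 1 + m with hv
  have hX : numLinear 2 d (v + 1) 0 = #{t ∈ linSet d (v + 1) | loopSet t = ∅} := by
    rw [numLinear_eq]
    simp only [card_eq_zero]
  have h1 := card_filter_add_card_filter_not (s := {t ∈ linSet d (v + 1) | loopSet t = ∅})
    (fun t => Axial t 0)
  have h2 := card_filter_add_card_filter_not
    (s := {t ∈ linSet d (v + 1) | loopSet t = ∅ ∧ ¬ Axial t 0}) (fun t => Axial t v)
  have h3 := card_filter_add_card_filter_not
    (s := {t ∈ linSet d (v + 1) | loopSet t = ∅ ∧ Axial t v}) (fun t => Axial t 0)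
  have h4 := card_filter_add_card_filter_not
    (s := {t ∈ linSet d (v + 1) | loopSet t = ∅ ∧ Axial t 0}) (fun t => v ∈ blk t 0)
  have h5 := card_filter_add_card_filter_not
    (s := {t ∈ linSet d (v + 1) | (loopSet t = ∅ ∧ Axial t v) ∧ Axial t 0}) (fun t => v ∈ blk t 0)
  have h6 := card_axial_last d v
  simp only [filter_filter] at h1 h2 h3 h4 h5
  have hmem : #{t ∈ linSet d (v + 1) | (loopSet t = ∅ ∧ Axial t 0) ∧ v ∈ blk t 0} =
      #{s ∈ frontSet d (m + 1) (v + 1) | loopSet s = ∅ ∧ v ∈ blk s 0} := by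
    congr 1
    ext t
    rw [mem_filter, mem_filter, hd, isFront_iff_axial]
    tauto
  have hnot : #{t ∈ linSet d (v + 1) | (loopSet t = ∅ ∧ Axial t 0) ∧ v ∉ blk t 0} =
      #{s ∈ frontSet d (m + 1) (v + 1) | loopSet s = ∅ ∧ v ∉ blk s 0} := by
    congr 1
    ext t
    rw [mem_filter, mem_filter, hd, isFront_iff_axial]
    tauto
  have hmem' : #{t ∈ linSet d (v + 1) | ((loopSet t = ∅ ∧ Axial t v) ∧ Axial t 0) ∧ v ∈ blk t 0} =
      #{s ∈ frontSet d (m + 1) (v + 1) | loopSet s = ∅ ∧ v ∈ blk s 0} := by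
    congr 1
    ext t
    rw [mem_filter, mem_filter, hd, isFront_iff_axial, mem_linSet]
    constructor
    · tauto
    · rintro ⟨⟨h7, h8⟩, h9, h10⟩
      exact ⟨h7, ⟨⟨h9, h8.of_mem_blk h7.2 h10⟩, h8⟩, h10⟩
  have hdbl : #{t ∈ linSet d (v + 1) | ((loopSet t = ∅ ∧ Axial t v) ∧ Axial t 0) ∧ v ∉ blk t 0} =
      #{s ∈ doubleSet d (m + 1) v | loopSet s = ∅} := by
    congr 1
    ext t
    rw [mem_filter, mem_filter, hd, isDouble_iff_axial]
    tauto
  have e1 := card_frontSet_loopless_mem d (u + m) m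
  have e2 := card_frontSet_loopless_notMem d (u + m) m
  have e3 := card_doubleSet_loopless d u m
  have h8 : #{t ∈ linSet d (v + 1) | (loopSet t = ∅ ∧ ¬ Axial t 0) ∧ Axial t v} =
      #{t ∈ linSet d (v + 1) | (loopSet t = ∅ ∧ Axial t v) ∧ ¬ Axial t 0} := by
    congr 1
    exact filter_congr fun t _ => by tauto
  have h9 : #{t ∈ linSet d (v + 1) | (loopSet t = ∅ ∧ ¬ Axial t 0) ∧ ¬ Axial t v} =
      #{t ∈ linSet d (v + 1) | loopSet t = ∅ ∧ ¬ Axial t 0 ∧ ¬ Axial t v} := by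
    congr 1
    exact filter_congr fun t _ => by tauto
  rw [← e1, ← e2, ← e3, hX, ← h9]
  rw [hmem, hnot] at h4
  rw [hmem', hdbl] at h5
  rw [h8] at h2
  change _ = _ - 2 * ((#{s ∈ frontSet d (m + 1) (v + 1) | loopSet s = ∅ ∧ v ∉ blk s 0} : ℕ) : ℤ)
    + ((#{s ∈ doubleSet d (m + 1) v | loopSet s = ∅} : ℕ) : ℤ)
    - ((#{s ∈ frontSet d (m + 1) (v + 1) | loopSet s = ∅ ∧ v ∈ blk s 0} : ℕ) : ℤ)
  omega

/-! ### Counting orbits -/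

section
variable {d n : ℕ}

instance finite_looplessDiagram [NeZero (d * n)] : Finite (LooplessDiagram d n) :=
  have := finite_setoid (ZMod (d * n))
  Subtype.finite

theorem numFixed_conj (g h : DihedralGroup (d * n)) :
    numFixed d n (h * g * h⁻¹) = numFixed d n g := by
  rw [numFixed, numFixed, ← MulAction.smul_fixedBy, Set.natCard_smul_set]

/-- A rotation through `i` steps generates the same subgroup as the one through `gcd(dn, i)`
steps, so both fix the same diagrams. -/
theorem numFixed_r [NeZero (d * n)] (i : ZMod (d * n)) :
    numFixed d n (DihedralGroup.r i) = rotSym d n (orderOf (DihedralGroup.r i)) := by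
  rw [rotSym, DihedralGroup.orderOf_r,
    Nat.div_div_self (Nat.gcd_dvd_left _ _) (NeZero.ne (d * n))]
  set g := (d * n).gcd i.val with hg
  have h1 : ∃ k : ℤ, DihedralGroup.r i = DihedralGroup.r ((g : ℕ) : ZMod (d * n)) ^ k := by
    obtain ⟨c, hc⟩ := Nat.gcd_dvd_right (d * n) i.val
    refine ⟨c, ?_⟩
    rw [DihedralGroup.r_zpow]
    congr 1
    conv_lhs => rw [← ZMod.natCast_zmod_val i, hc]
    push_cast
    rfl
  have h2 : ∃ k : ℤ, DihedralGroup.r ((g : ℕ) : ZMod (d * n)) = DihedralGroup.r i ^ k := by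
    refine ⟨(d * n).gcdB i.val, ?_⟩
    rw [DihedralGroup.r_zpow]
    congr 1
    have h := congrArg (Int.cast : ℤ → ZMod (d * n)) (Nat.gcd_eq_gcd_ab (d * n) i.val)
    rw [Int.cast_natCast, ← hg, Int.cast_add, Int.cast_mul, Int.cast_mul, Int.cast_natCast,
      Int.cast_natCast, ZMod.natCast_self, zero_mul, zero_add, ZMod.natCast_zmod_val] at h
    exact h
  obtain ⟨k, hk⟩ := h1
  obtain ⟨l, hl⟩ := h2
  rw [numFixed, numFixed]
  congr 1
  refine congrArg _ (Set.Subset.antisymm ?_ ?_)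
  · conv_rhs => rw [hl]
    exact MulAction.fixedBy_subset_fixedBy_zpow _ _ _
  · conv_rhs => rw [hk]
    exact MulAction.fixedBy_subset_fixedBy_zpow _ _ _

/-- There are `φ(m)` rotations of each order `m` dividing `dn`. -/
theorem sum_numFixed_r [NeZero (d * n)] :
    ∑ i : ZMod (d * n), numFixed d n (DihedralGroup.r i) =
      ∑ m ∈ (d * n).divisors, Nat.totient m * rotSym d n m := by
  have hord : ∀ i : ZMod (d * n), orderOf (DihedralGroup.r i) = addOrderOf i := by
    intro i
    rw [DihedralGroup.orderOf_r]
    conv_rhs => rw [← ZMod.natCast_zmod_val i, ZMod.addOrderOf_coe _ (NeZero.ne (d * n))]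
  rw [← sum_fiberwise_of_maps_to (t := (d * n).divisors) (g := fun i => addOrderOf i)]
  · refine sum_congr rfl fun m hm => ?_
    have hc := IsAddCyclic.card_addOrderOf_eq_totient (α := ZMod (d * n)) (d := m)
      (by rw [ZMod.card]; exact Nat.dvd_of_mem_divisors hm)
    refine Eq.trans (sum_congr rfl (g := fun _ => rotSym d n m) fun i hi => ?_)
      (by rw [sum_const, smul_eq_mul, hc])
    rw [numFixed_r, hord, (mem_filter.1 hi).2]
  · intro i _
    rw [Nat.mem_divisors]
    refine ⟨?_, NeZero.ne _⟩
    have := addOrderOf_dvd_card (x := i)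
    rwa [ZMod.card] at this

/-- The reflections `x ↦ -a - x` and `x ↦ -(a + 2b) - x` are conjugate under a rotation, hence fix
equally many diagrams. -/
theorem numFixed_sr_add (a b : ZMod (d * n)) :
    numFixed d n (DihedralGroup.sr (a + 2 * b)) = numFixed d n (DihedralGroup.sr a) := by
  rw [← numFixed_conj (DihedralGroup.sr a) (DihedralGroup.r (-b)), DihedralGroup.inv_r,
    DihedralGroup.r_mul_sr, DihedralGroup.sr_mul_r]
  congr 2
  ring

end

theorem axisPoints_eq (N : ℕ) (a : ZMod N) : axisPoints N a = {x : ZMod N | -a - x = x}.ncard := rfl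

theorem axisPoints_add (N : ℕ) (a b : ZMod N) : axisPoints N (a + 2 * b) = axisPoints N a := by
  rw [axisPoints_eq, axisPoints_eq, ← Set.ncard_image_of_injective {x | -a - x = x}
    (sub_left_injective (b := b))]
  congr 1
  ext x
  constructor
  · intro h
    refine ⟨x + b, ?_, by ring⟩
    change -a - (x + b) = x + b
    have h : -(a + 2 * b) - x = x := h
    linear_combination h
  · rintro ⟨y, h, rfl⟩
    change -(a + 2 * b) - (y - b) = y - b
    have h : -a - y = y := h
    linear_combination h

theorem axisPoints_one_of_even {N : ℕ} (hN : Even N) : axisPoints N 1 = 0 := by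
  have hempty : {x : ZMod N | -1 - x = x} = ∅ := by
    rw [Set.eq_empty_iff_forall_notMem]
    intro x hx
    have hx : -1 - x = x := hx
    obtain ⟨z, rfl⟩ := ZMod.intCast_surjective x
    have h : ((2 * z + 1 : ℤ) : ZMod N) = 0 := by
      push_cast
      linear_combination -hx
    rw [ZMod.intCast_zmod_eq_zero_iff_dvd] at h
    obtain ⟨c, hc⟩ := h
    obtain ⟨k, hk⟩ := hN
    rw [hk] at hc
    push_cast at hc
    have : 2 * z + 1 = 2 * (k * c) := by linear_combination hc
    omega
  rw [axisPoints_eq, hempty, Set.ncard_empty]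

theorem axisPoints_zero_of_even {N : ℕ} [NeZero N] (hN : Even N) : axisPoints N 0 = 2 := by
  obtain ⟨k, hk⟩ := hN
  have hN0 := NeZero.ne N
  rw [axisPoints_eq, Set.ncard_eq_two]
  refine ⟨0, (k : ZMod N), ?_, ?_⟩
  · intro h
    have := natCast_inj_of_lt (N := N) (p := 0) (q := k) (by omega) (by omega) (by simpa using h)
    omega
  · ext x
    have hx : x ∈ {x : ZMod N | -0 - x = x} ↔ N ∣ x.val + x.val + 0 := by
      rw [dvd_iff_reflect_eq, ZMod.natCast_zmod_val, Nat.cast_zero]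
      exact eq_comm
    rw [hx, Set.mem_insert_iff, Set.mem_singleton_iff]
    have hlt := x.val_lt
    constructor
    · rintro ⟨c, hc⟩
      have hv : x.val = 0 ∨ x.val = k := by
        rcases Nat.lt_or_ge c 2 with hc2 | hc2
        · interval_cases c <;> omega
        · have : N * 2 ≤ N * c := Nat.mul_le_mul_left _ hc2
          omega
      rcases hv with h | h
      · exact Or.inl ((ZMod.val_eq_zero x).1 h)
      · exact Or.inr (by rw [← h, ZMod.natCast_zmod_val])
    · rintro (rfl | rfl)
      · simp
      · rw [ZMod.val_natCast_of_lt (by omega)]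
        exact ⟨1, by omega⟩

theorem axisPoints_zero_of_odd {N : ℕ} [NeZero N] (hN : Odd N) : axisPoints N 0 = 1 := by
  rw [axisPoints_eq, Set.ncard_eq_one]
  refine ⟨0, ?_⟩
  ext x
  have hx : x ∈ {x : ZMod N | -0 - x = x} ↔ N ∣ x.val + x.val + 0 := by
    rw [dvd_iff_reflect_eq, ZMod.natCast_zmod_val, Nat.cast_zero]
    exact eq_comm
  rw [hx, Set.mem_singleton_iff]
  have hlt := x.val_lt
  obtain ⟨k, hk⟩ := hN
  constructor
  · rintro ⟨c, hc⟩
    refine (ZMod.val_eq_zero x).1 ?_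
    rcases Nat.lt_or_ge c 2 with hc2 | hc2
    · interval_cases c <;> omega
    · have : N * 2 ≤ N * c := Nat.mul_le_mul_left _ hc2
      omega
  · rintro rfl
    simp

/-- Up to rotations there are at most two axes, of `x ↦ -x` and of `x ↦ -1 - x`. -/
theorem exists_eq_two_mul (N : ℕ) (a : ZMod N) : ∃ b, a = 0 + 2 * b ∨ a = 1 + 2 * b := by
  obtain ⟨z, rfl⟩ := ZMod.intCast_surjective a
  refine ⟨((z / 2 : ℤ) : ZMod N), ?_⟩
  rcases Int.emod_two_eq_zero_or_one z with h | h
  · left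
    have hz : z = 2 * (z / 2) := by omega
    conv_lhs => rw [hz]
    push_cast
    ring
  · right
    have hz : z = 1 + 2 * (z / 2) := by omega
    conv_lhs => rw [hz]
    push_cast
    ring

/-- If `N` is odd, all axes are equivalent. -/
theorem exists_one_eq_of_odd {N : ℕ} (hN : Odd N) : ∃ b : ZMod N, 1 = 0 + 2 * b := by
  obtain ⟨k, hk⟩ := hN
  refine ⟨-k, ?_⟩
  have : ((2 * k + 1 : ℕ) : ZMod N) = 0 := by rw [← hk, ZMod.natCast_self]
  push_cast at this
  linear_combination this

theorem exists_eq_two_mul_of_odd {N : ℕ} (hN : Odd N) (a : ZMod N) : ∃ b, a = 0 + 2 * b := by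
  obtain ⟨b, rfl | rfl⟩ := exists_eq_two_mul N a
  · exact ⟨b, rfl⟩
  · obtain ⟨c, hc⟩ := exists_one_eq_of_odd hN
    exact ⟨c + b, by rw [hc]; ring⟩

/-- Axes passing through equally many points are equivalent under rotations. -/
theorem numFixed_sr_eq_reflSym {d n : ℕ} [NeZero (d * n)] (a : ZMod (d * n)) :
    numFixed d n (DihedralGroup.sr a) = reflSym d n (axisPoints (d * n) a) := by
  have h : ∃ a', axisPoints (d * n) a' = axisPoints (d * n) a := ⟨a, rfl⟩
  rw [reflSym, dif_pos h]
  have hc := h.choose_spec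
  generalize h.choose = a' at hc ⊢
  rcases Nat.even_or_odd (d * n) with he | ho
  · have h0 := axisPoints_zero_of_even he
    have h1 := axisPoints_one_of_even he
    obtain ⟨b, rfl | rfl⟩ := exists_eq_two_mul _ a <;>
      obtain ⟨b', rfl | rfl⟩ := exists_eq_two_mul _ a' <;>
      rw [axisPoints_add, axisPoints_add] at hc
    · rw [numFixed_sr_add, numFixed_sr_add]
    · omega
    · omega
    · rw [numFixed_sr_add, numFixed_sr_add]
  · obtain ⟨b, rfl⟩ := exists_eq_two_mul_of_odd ho a
    obtain ⟨b', rfl⟩ := exists_eq_two_mul_of_odd ho a'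
    rw [numFixed_sr_add, numFixed_sr_add]

section
variable {d n : ℕ} [NeZero (d * n)]

theorem reflSym_zero_of_even (h : Even (d * n)) :
    reflSym d n 0 = numFixed d n (DihedralGroup.sr 1) := by
  rw [numFixed_sr_eq_reflSym, axisPoints_one_of_even h]

theorem reflSym_two_of_even (h : Even (d * n)) :
    reflSym d n 2 = numFixed d n (DihedralGroup.sr 0) := by
  rw [numFixed_sr_eq_reflSym, axisPoints_zero_of_even h]

theorem reflSym_one_of_odd (h : Odd (d * n)) :
    reflSym d n 1 = numFixed d n (DihedralGroup.sr 0) := by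
  rw [numFixed_sr_eq_reflSym, axisPoints_zero_of_odd h]

theorem reflSym_of_odd (h : Odd (d * n)) {i : ℕ} (hi : i ≠ 1) : reflSym d n i = 0 := by
  rw [reflSym, dif_neg]
  rintro ⟨a, ha⟩
  obtain ⟨b, rfl⟩ := exists_eq_two_mul_of_odd h a
  rw [axisPoints_add, axisPoints_zero_of_odd h] at ha
  exact hi ha.symm

theorem reflSym_one_of_even (h : Even (d * n)) : reflSym d n 1 = 0 := by
  rw [reflSym, dif_neg]
  rintro ⟨a, ha⟩
  obtain ⟨b, rfl | rfl⟩ := exists_eq_two_mul _ a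
  · rw [axisPoints_add, axisPoints_zero_of_even h] at ha
    omega
  · rw [axisPoints_add, axisPoints_one_of_even h] at ha
    omega

/-- Two consecutive axes represent all types of axes, in the right proportion. -/
theorem numFixed_sr_add_succ (a : ZMod (d * n)) :
    numFixed d n (DihedralGroup.sr a) + numFixed d n (DihedralGroup.sr (a + 1)) =
      reflSym d n 0 + 2 * reflSym d n 1 + reflSym d n 2 := by
  rcases Nat.even_or_odd (d * n) with he | ho
  · rw [reflSym_one_of_even he, reflSym_zero_of_even he, reflSym_two_of_even he]
    obtain ⟨b, rfl | rfl⟩ := exists_eq_two_mul _ a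
    · rw [show (0 + 2 * b + 1 : ZMod (d * n)) = 1 + 2 * b by ring, numFixed_sr_add,
        numFixed_sr_add]
      omega
    · rw [show (1 + 2 * b + 1 : ZMod (d * n)) = 0 + 2 * (b + 1) by ring, numFixed_sr_add,
        numFixed_sr_add]
      omega
  · rw [reflSym_of_odd ho zero_ne_one, reflSym_of_odd ho (i := 2) (by norm_num),
      reflSym_one_of_odd ho]
    obtain ⟨b, hb⟩ := exists_eq_two_mul_of_odd ho a
    obtain ⟨c, hc⟩ := exists_eq_two_mul_of_odd ho (a + 1)
    rw [hc, numFixed_sr_add, hb, numFixed_sr_add]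
    omega

theorem two_mul_sum_numFixed_sr :
    2 * ∑ a : ZMod (d * n), numFixed d n (DihedralGroup.sr a) =
      d * n * (reflSym d n 0 + 2 * reflSym d n 1 + reflSym d n 2) := by
  have h1 : ∑ a : ZMod (d * n), numFixed d n (DihedralGroup.sr (a + 1)) =
      ∑ a : ZMod (d * n), numFixed d n (DihedralGroup.sr a) :=
    Equiv.sum_comp (Equiv.addRight (1 : ZMod (d * n))) fun a => numFixed d n (DihedralGroup.sr a)
  calc 2 * ∑ a : ZMod (d * n), numFixed d n (DihedralGroup.sr a)
      = ∑ a : ZMod (d * n), (numFixed d n (DihedralGroup.sr a) +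
          numFixed d n (DihedralGroup.sr (a + 1))) := by rw [sum_add_distrib, h1, two_mul]
    _ = _ := by
      rw [sum_congr rfl fun a _ => numFixed_sr_add_succ a, sum_const, card_univ, ZMod.card,
        smul_eq_mul]

/-- Burnside's lemma for the action of the dihedral group. -/
theorem sum_numFixed :
    ∑ i : ZMod (d * n), numFixed d n (DihedralGroup.r i) +
      ∑ a : ZMod (d * n), numFixed d n (DihedralGroup.sr a) =
    numUnlabelled d n * (2 * (d * n)) := by
  classical
  have : Fintype (LooplessDiagram d n) := Fintype.ofFinite _
  have hF : ∀ g : DihedralGroup (d * n), Fintype (MulAction.fixedBy (LooplessDiagram d n) g) :=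
    fun g => Fintype.ofFinite _
  have hQ : Fintype (MulAction.orbitRel.Quotient (DihedralGroup (d * n)) (LooplessDiagram d n)) :=
    Fintype.ofFinite _
  have hB := MulAction.sum_card_fixedBy_eq_card_orbits_mul_card_group (DihedralGroup (d * n))
    (LooplessDiagram d n)
  rw [DihedralGroup.card, ← Nat.card_eq_fintype_card] at hB
  rw [numUnlabelled, ← hB]
  let e : ZMod (d * n) ⊕ ZMod (d * n) ≃ DihedralGroup (d * n) :=
    { toFun := Sum.elim DihedralGroup.r DihedralGroup.sr
      invFun := fun g => match g with
        | DihedralGroup.r i => Sum.inl i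
        | DihedralGroup.sr i => Sum.inr i
      left_inv := by rintro (i | i) <;> rfl
      right_inv := by rintro (i | i) <;> rfl }
  rw [← Equiv.sum_comp e, Fintype.sum_sum_type]
  congr 1 <;>
  · refine sum_congr rfl fun i _ => ?_
    exact Nat.card_eq_fintype_card

theorem numUnlabelled_eq (hd : 1 ≤ d) (hn : 1 ≤ n) :
    (numUnlabelled d n : ℚ) =
      1 / (2 * d * n) * ∑ m ∈ (d * n).divisors, (Nat.totient m : ℚ) * (rotSym d n m : ℚ) +
        ((reflSym d n 0 : ℚ) + 2 * reflSym d n 1 + reflSym d n 2) / 4 := by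
  have h1 := congrArg (Nat.cast : ℕ → ℚ) (sum_numFixed (d := d) (n := n))
  have h2 := congrArg (Nat.cast : ℕ → ℚ) (two_mul_sum_numFixed_sr (d := d) (n := n))
  rw [sum_numFixed_r] at h1
  push_cast at h1 h2
  have hd0 : (d : ℚ) ≠ 0 := Nat.cast_ne_zero.2 (by omega)
  have hn0 : (n : ℚ) ≠ 0 := Nat.cast_ne_zero.2 (by omega)
  field_simp
  linear_combination (-4) * h1 + 2 * h2

end

/-! ### The formulas for the symmetric diagrams -/

theorem alpha1_eq (m c k : ℕ) : alpha1 (2 * (m + 1)) (c + 2) k =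
    binom ((((m + 1) * c + m : ℕ) : ℤ) - k) ((m : ℤ) - k) := by
  rw [alpha1, Nat.mul_div_cancel_left _ two_pos]
  congr 1 <;> push_cast <;> ring

theorem alpha3_eq (m c k : ℕ) : alpha3 (2 * (m + 1)) (c + 2) k =
    binom ((((m + 1) * c + m : ℕ) : ℤ) - k) ((m : ℤ) - 1 - k) := by
  rw [alpha3, Nat.mul_div_cancel_left _ two_pos]
  congr 1 <;> push_cast <;> ring

theorem alpha2_eq (m c k : ℕ) : alpha2 (2 * (m + 1)) (c + 2) k =
    doubleCoeff ((m + 1) * c) m k := by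
  rw [alpha2, doubleCoeff, Nat.mul_div_cancel_left _ two_pos]
  refine sum_congr rfl fun j _ => sum_congr (by rw [Nat.add_sub_cancel]) fun s _ => ?_
  congr 1
  · congr 2
    · congr 1
      push_cast
      ring
    · push_cast
      ring
    · push_cast
      ring
  · congr 1 <;> push_cast <;> ring

/-- `d` is even: if no point lies on the axis, inclusion and exclusion applies; if two points do,
they lie in a common block. -/
theorem reflSym_formula_even {d n : ℕ} (hd : 1 ≤ d) (hn : 2 ≤ n) (h : Even d) :
    (reflSym d n 0 : ℤ) =
        numLinear 2 d (d * n / 2) 0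
        - 2 * ∑ k ∈ range (d / 2), alpha1 d n k * numLinear 2 d (d * (n - 1) / 2) k
        + ∑ k ∈ range (d - 1), alpha2 d n k * numLinear 2 d (d * (n - 2) / 2) k
        - ∑ k ∈ range (d / 2 - 1), alpha3 d n k * numLinear 2 d (d * (n - 1) / 2) k ∧
    (reflSym d n 2 : ℤ) =
        ∑ k ∈ range (d / 2), alpha1 d n k * numLinear 2 d (d * (n - 1) / 2) k := by
  classical
  obtain ⟨m, rfl⟩ : ∃ m, d = 2 * (m + 1) := by
    obtain ⟨e, he⟩ := h
    exact ⟨e - 1, by omega⟩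
  obtain ⟨c, rfl⟩ : ∃ c, n = c + 2 := ⟨n - 2, by omega⟩
  have : NeZero (2 * (m + 1) * (c + 2)) := ⟨by positivity⟩
  have hev : Even (2 * (m + 1) * (c + 2)) := (h.mul_right _)
  set u := (m + 1) * c with hu
  have e0 : 2 * (m + 1) * (c + 2) = 2 * (u + m + 1 + m + 1) := by rw [hu]; ring
  have e1 : 2 * (m + 1) * (c + 2 - 1) = 2 * (u + m + 1) := by
    rw [hu, show c + 2 - 1 = c + 1 by omega]; ring
  have e2 : 2 * (m + 1) * (c + 2 - 2) = 2 * u := by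
    rw [hu, Nat.add_sub_cancel]; ring
  have hsum1 : ∑ k ∈ range (2 * (m + 1) / 2), alpha1 (2 * (m + 1)) (c + 2) k *
      (numLinear 2 (2 * (m + 1)) (u + m + 1) k : ℤ) = ∑ s' ∈ linSet (2 * (m + 1)) (u + m + 1),
        binom (((u + m : ℕ) : ℤ) - #(loopSet s')) ((m : ℤ) - #(loopSet s')) := by
    rw [sum_linSet _ _ (m + 1) (fun k => binom (((u + m : ℕ) : ℤ) - k) ((m : ℤ) - k))
      (fun k hk => binom_eq_zero (by omega)), Nat.mul_div_cancel_left _ two_pos]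
    exact sum_congr rfl fun k _ => by rw [alpha1_eq]
  have hsum2 : ∑ k ∈ range (2 * (m + 1) - 1), alpha2 (2 * (m + 1)) (c + 2) k *
      (numLinear 2 (2 * (m + 1)) u k : ℤ) =
      ∑ s' ∈ linSet (2 * (m + 1)) u, doubleCoeff u m #(loopSet s') := by
    rw [sum_linSet _ _ (2 * m + 1) (fun k => doubleCoeff u m k)
      (fun k hk => doubleCoeff_eq_zero hk), show 2 * (m + 1) - 1 = 2 * m + 1 by omega]
    exact sum_congr rfl fun k _ => by rw [alpha2_eq]
  have hsum3 : ∑ k ∈ range (2 * (m + 1) / 2 - 1), alpha3 (2 * (m + 1)) (c + 2) k *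
      (numLinear 2 (2 * (m + 1)) (u + m + 1) k : ℤ) = ∑ s' ∈ linSet (2 * (m + 1)) (u + m + 1),
        binom (((u + m : ℕ) : ℤ) - #(loopSet s')) ((m : ℤ) - 1 - #(loopSet s')) := by
    rw [sum_linSet _ _ m (fun k => binom (((u + m : ℕ) : ℤ) - k) ((m : ℤ) - 1 - k))
      (fun k hk => binom_eq_zero (by omega)), Nat.mul_div_cancel_left _ two_pos,
      Nat.add_sub_cancel]
    exact sum_congr rfl fun k _ => by rw [alpha3_eq]
  rw [e1, e2, Nat.mul_div_cancel_left (u + m + 1) two_pos, Nat.mul_div_cancel_left u two_pos, hsum1,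
    hsum2, hsum3]
  constructor
  · have hshape : FoldShape (2 * (m + 1) * (c + 2)) 1 (u + m + 1 + m + 1) :=
      ⟨by omega, Or.inl ⟨le_rfl, by omega⟩⟩
    have hcard := hshape.card_isReflected (2 * (m + 1))
    rw [Nat.subtype_card {t ∈ linSet (2 * (m + 1)) (u + m + 1 + m + 1) |
      loopSet t = ∅ ∧ ¬ Axial t 0 ∧ ¬ Axial t (u + m + 1 + m)}
      (fun t => by rw [mem_filter, isFolded_no_point e0]), Nat.cast_one] at hcard
    rw [reflSym_zero_of_even hev, numFixed_sr, hcard, card_no_point_even, e0,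
      Nat.mul_div_cancel_left _ two_pos]
  · have hN : 2 * (m + 1) * (c + 2) = 2 * (u + m + 1 + m) + 2 := by omega
    have hshape : FoldShape (2 * (m + 1) * (c + 2)) 0 (u + m + 1 + m + 2) :=
      ⟨by omega, Or.inr ⟨rfl, by omega⟩⟩
    have hcard := hshape.card_isReflected (2 * (m + 1))
    rw [Nat.subtype_card {t ∈ frontSet (2 * (m + 1)) (m + 1 + 1) (u + m + 1 + m + 2) |
      loopSet t = ∅ ∧ u + m + 1 + m + 1 ∈ blk t 0}
      (fun t => by rw [mem_filter, isFolded_two_points_even hN]), Nat.cast_zero] at hcard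
    rw [reflSym_two_of_even hev, numFixed_sr, hcard]
    have := card_frontSet_loopless_mem (2 * (m + 1)) (u + m) (m + 1)
    rw [Nat.cast_succ, add_sub_cancel_right] at this
    exact this

/-- `d` is odd and `n` is even: if no point lies on the axis, there is no symmetric block; if two
points do, they lie in different blocks. -/
theorem reflSym_formula_odd_even {d n : ℕ} (hn : 2 ≤ n) (hd : Odd d) (hne : Even n) :
    reflSym d n 0 = numLinear 2 d (d * n / 2) 0 ∧
    (reflSym d n 2 : ℤ) =
        ∑ k ∈ range d, ∑ j ∈ range ((d - 1) / 2 + 1),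
          ∑ s ∈ range (min k ((d - 1) / 2 - j) + 1),
            binom ((d - 1) / 2 : ℕ) j * binom k s *
              binom ((d * (n - 2) / 2 : ℕ) - k) (((d - 1) / 2 : ℕ) - j - s) *
              binom (((d * (n - 1) - 1) / 2 : ℕ) - (k + j - s))
                (((d - 1) / 2 : ℕ) - (k + j - s)) *
              numLinear 2 d (d * (n - 2) / 2) k := by
  classical
  obtain ⟨m, rfl⟩ := hd
  obtain ⟨c, rfl⟩ : ∃ c, n = 2 * c + 2 := by
    obtain ⟨e, he⟩ := hne
    exact ⟨e - 1, by omega⟩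
  have : NeZero ((2 * m + 1) * (2 * c + 2)) := ⟨by positivity⟩
  have hev : Even ((2 * m + 1) * (2 * c + 2)) := hne.mul_left _
  set u := (2 * m + 1) * c with hu
  have e0 : (2 * m + 1) * (2 * c + 2) = 2 * (u + m + 1 + m) := by rw [hu]; ring
  have e1 : (2 * m + 1) * (2 * c + 2 - 1) - 1 = 2 * (u + m) := by
    rw [show 2 * c + 2 - 1 = 2 * c + 1 by omega,
      show (2 * m + 1) * (2 * c + 1) = 2 * (u + m) + 1 by rw [hu]; ring, Nat.add_sub_cancel]
  have e2 : (2 * m + 1) * (2 * c + 2 - 2) = 2 * u := by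
    rw [hu, Nat.add_sub_cancel]; ring
  have hum : 1 ≤ u + m + 1 + m := by omega
  constructor
  · obtain ⟨v, hv⟩ : ∃ v, u + m + 1 + m = v + 1 := ⟨u + m + m, by omega⟩
    rw [hv] at e0
    have hshape : FoldShape ((2 * m + 1) * (2 * c + 2)) 1 (v + 1) :=
      ⟨by omega, Or.inl ⟨le_rfl, by omega⟩⟩
    have hcard := hshape.card_isReflected (2 * m + 1)
    rw [Nat.subtype_card {t ∈ linSet (2 * m + 1) (v + 1) | #(loopSet t) = 0}
      (fun t => by
        rw [mem_filter, isFolded_no_point e0, card_eq_zero]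
        exact ⟨fun h => ⟨h.1, h.2, not_axial_of_odd h.1 0, not_axial_of_odd h.1 v⟩,
          fun h => ⟨h.1, h.2.1⟩⟩), Nat.cast_one] at hcard
    rw [reflSym_zero_of_even hev, numFixed_sr, hcard, e0,
      Nat.mul_div_cancel_left _ two_pos, numLinear_eq]
  · have hN : (2 * m + 1) * (2 * c + 2) = 2 * (u + m + m) + 2 := by omega
    have hshape : FoldShape ((2 * m + 1) * (2 * c + 2)) 0 (u + m + m + 2) :=
      ⟨by omega, Or.inr ⟨rfl, by omega⟩⟩
    have hcard := hshape.card_isReflected (2 * m + 1)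
    rw [Nat.subtype_card {t ∈ doubleSet (2 * m + 1) (m + 1) (u + m + m + 1) | loopSet t = ∅}
      (fun t => by rw [mem_filter, isFolded_two_points_odd hN]), Nat.cast_zero] at hcard
    rw [reflSym_two_of_even hev, numFixed_sr, hcard,
      show u + m + m + 1 = u + m + 1 + m by omega, card_doubleSet_loopless,
      sum_linSet _ _ (2 * m + 1) (fun k => doubleCoeff u m k) (fun k hk => doubleCoeff_eq_zero hk)]
    rw [e1, e2, Nat.add_sub_cancel, Nat.mul_div_cancel_left _ two_pos,
      Nat.mul_div_cancel_left _ two_pos, Nat.mul_div_cancel_left _ two_pos]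
    refine sum_congr rfl fun k _ => ?_
    rw [doubleCoeff, sum_mul]
    refine sum_congr rfl fun j _ => ?_
    rw [sum_mul]
    push_cast
    rfl

/-- `d` and `n` are odd: there is one point on the axis, and at the other end of the axis there must
be no loop, so the last points of the sectors do not lie in the block of the first ones. -/
theorem reflSym_formula_odd_odd {d n : ℕ} (hn : 2 ≤ n) (hd : Odd d) (hno : Odd n) :
    (reflSym d n 1 : ℤ) =
        ∑ k ∈ range ((d - 1) / 2 + 1),
          binom ((d * (n - 1) / 2 : ℕ) - 1 - k) (((d - 1) / 2 : ℕ) - k) *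
            numLinear 2 d (d * (n - 1) / 2) k := by
  classical
  have hodd : Odd (d * n) := hd.mul hno
  obtain ⟨m, rfl⟩ := hd
  obtain ⟨c, rfl⟩ : ∃ c, n = 2 * (c + 1) + 1 := by
    obtain ⟨e, he⟩ := hno
    exact ⟨e - 1, by omega⟩
  have : NeZero ((2 * m + 1) * (2 * (c + 1) + 1)) := ⟨by positivity⟩
  obtain ⟨w, hw⟩ : ∃ w, (2 * m + 1) * (c + 1) = w + 1 :=
    ⟨(2 * m + 1) * (c + 1) - 1, by
      have : 0 < (2 * m + 1) * (c + 1) := by positivity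
      omega⟩
  have e1 : (2 * m + 1) * (2 * (c + 1) + 1 - 1) = 2 * (w + 1) := by
    rw [← hw, Nat.add_sub_cancel]; ring
  have hN : (2 * m + 1) * (2 * (c + 1) + 1) = 2 * (w + 1 + m) + 1 := by
    rw [show (2 * m + 1) * (2 * (c + 1) + 1) = 2 * ((2 * m + 1) * (c + 1)) + 2 * m + 1 by ring, hw]
    ring
  have hshape : FoldShape ((2 * m + 1) * (2 * (c + 1) + 1)) 0 (w + 1 + m + 1) :=
    ⟨by omega, Or.inl ⟨zero_le_one, by omega⟩⟩
  have hcard := hshape.card_isReflected (2 * m + 1)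
  rw [Nat.subtype_card {t ∈ frontSet (2 * m + 1) (m + 1) (w + 1 + m + 1) |
    loopSet t = ∅ ∧ w + 1 + m ∉ blk t 0}
    (fun t => by rw [mem_filter, isFolded_one_point (by omega) hN]), Nat.cast_zero] at hcard
  rw [reflSym_one_of_odd hodd, numFixed_sr, hcard,
    card_frontSet_loopless_notMem,
    sum_linSet _ _ (m + 1) (fun k => binom ((w : ℤ) - k) ((m : ℤ) - k))
      (fun k hk => binom_eq_zero (by omega)), e1, Nat.add_sub_cancel,
    Nat.mul_div_cancel_left _ two_pos, Nat.mul_div_cancel_left _ two_pos, Nat.cast_succ,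
    add_sub_cancel_right]

/-! ### Hamiltonian cycles as cyclic orderings of the vertices -/

/-- The set of edges joining cyclically consecutive terms of `f`. -/
def cyclicEdges {V : Type*} {N : ℕ} (f : ZMod N → V) : Set (Sym2 V) :=
  Set.range fun i => s(f i, f (i + 1))

/-- A cyclic ordering of the vertices in which neighbours are adjacent gives a Hamiltonian cycle,
the image of the cycle through the vertices of `SimpleGraph.cycleGraph`. -/
theorem exists_isHamiltonianCycle {V : Type*} [Fintype V] [DecidableEq V] {G : SimpleGraph V}
    {N : ℕ} (hN : 3 ≤ N) (f : ZMod N ≃ V) (hf : ∀ i, G.Adj (f i) (f (i + 1))) :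
    ∃ (u : V) (p : G.Walk u u), p.IsHamiltonianCycle ∧ p.edgeSet = cyclicEdges f := by
  obtain ⟨k, rfl⟩ : ∃ k, N = k + 3 := ⟨N - 3, by omega⟩
  let φ : SimpleGraph.cycleGraph (k + 3) →g G :=
    { toFun := f
      map_rel' := by
        intro a b hab
        rw [SimpleGraph.cycleGraph_adj] at hab
        have key : ∀ x y : ZMod (k + 3), x - y = 1 → G.Adj (f y) (f x) := by
          rintro x y h
          rw [← add_eq_of_eq_sub' h.symm]
          exact hf y
        rcases hab with h | h
        · exact (key a b h).symm
        · exact key b a h }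
  -- `SimpleGraph.cycleGraph.cycle` runs backwards
  have hget : ∀ m ≤ k + 3, ((SimpleGraph.cycleGraph.cycle k).map φ).getVert m =
      f (-(m : ZMod (k + 3))) := by
    intro m hm
    rw [SimpleGraph.Walk.getVert_map, SimpleGraph.cycleGraph.getVert_cycle hm]
    change f _ = _
    congr 1
    rw [← zero_sub, ← ZMod.natCast_self (k + 3), ← Nat.cast_sub hm]
    rfl
  have hlen : ((SimpleGraph.cycleGraph.cycle k).map φ).length = k + 3 := by
    rw [SimpleGraph.Walk.length_map, SimpleGraph.cycleGraph.length_cycle]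
  refine ⟨_, (SimpleGraph.cycleGraph.cycle k).map φ, ?_, ?_⟩
  · rw [SimpleGraph.Walk.isHamiltonianCycle_iff_isCycle_and_length_eq]
    refine ⟨SimpleGraph.cycleGraph.isCycle_cycle.map f.injective, ?_⟩
    rw [hlen, ← Fintype.card_congr f, ZMod.card]
  · ext e
    induction e using Sym2.ind with | _ x y => ?_
    rw [SimpleGraph.Walk.mem_edgeSet, SimpleGraph.Walk.mk_mem_edges_iff_exists, hlen]
    constructor
    · rintro ⟨i, hi, h⟩
      refine ⟨-((i + 1 : ℕ) : ZMod (k + 3)), ?_⟩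
      rw [← h, hget i hi.le, hget (i + 1) hi, Sym2.eq_swap]
      push_cast
      congr 3
      ring
    · rintro ⟨j, h⟩
      refine ⟨(-(j + 1)).val, ZMod.val_lt _, ?_⟩
      rw [← h, hget _ (ZMod.val_lt _).le, hget _ (ZMod.val_lt _), Sym2.eq_swap]
      push_cast
      rw [ZMod.natCast_zmod_val]
      congr 3 <;> ring

/-- The vertices of a Hamiltonian cycle, in the order in which it visits them. -/
theorem exists_cyclic_ordering {V : Type*} [Fintype V] [DecidableEq V] {G : SimpleGraph V}
    {N : ℕ} [NeZero N] (hN : Fintype.card V = N) {u : V} {p : G.Walk u u}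
    (hp : p.IsHamiltonianCycle) :
    ∃ f : ZMod N ≃ V, (∀ i, G.Adj (f i) (f (i + 1))) ∧ p.edgeSet = cyclicEdges f := by
  have hlen : p.length = N := hp.length_eq.trans hN
  have hinj : Function.Injective fun i : ZMod N => p.getVert i.val := by
    intro i j h
    have hi := ZMod.val_lt i
    have hj := ZMod.val_lt j
    refine ZMod.val_injective N (hp.isCycle.getVert_injOn' ?_ ?_ h)
    · change i.val ≤ p.length - 1
      omega
    · change j.val ≤ p.length - 1
      omega
  have hbij : Function.Bijective fun i : ZMod N => p.getVert i.val :=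
    (Fintype.bijective_iff_injective_and_card _).2 ⟨hinj, by rw [ZMod.card, hN]⟩
  have hsucc : ∀ i : ZMod N, p.getVert (i + 1).val = p.getVert (i.val + 1) := by
    intro i
    have hi := ZMod.val_lt i
    have hv : (i + 1).val = (i.val + 1) % N := by
      rw [← ZMod.val_natCast, Nat.cast_add, ZMod.natCast_zmod_val, Nat.cast_one]
    rcases (Nat.succ_le_of_lt hi).lt_or_eq with h | h
    · rw [hv, Nat.mod_eq_of_lt h]
    · rw [hv, show i.val + 1 = N from h, Nat.mod_self, SimpleGraph.Walk.getVert_zero, ← hlen,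
        SimpleGraph.Walk.getVert_length]
  refine ⟨Equiv.ofBijective _ hbij, fun i => ?_, ?_⟩
  · change G.Adj (p.getVert i.val) (p.getVert (i + 1).val)
    rw [hsucc]
    exact p.adj_getVert_succ (hlen ▸ ZMod.val_lt i)
  · ext e
    induction e using Sym2.ind with | _ x y => ?_
    rw [SimpleGraph.Walk.mem_edgeSet, SimpleGraph.Walk.mk_mem_edges_iff_exists, hlen]
    constructor
    · rintro ⟨i, hi, h⟩
      refine ⟨(i : ZMod N), ?_⟩
      change s(p.getVert _, p.getVert _) = _
      rw [hsucc, ZMod.val_natCast, Nat.mod_eq_of_lt hi, h]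
    · rintro ⟨j, h⟩
      refine ⟨j.val, ZMod.val_lt j, ?_⟩
      rw [← h, ← hsucc]
      rfl

theorem dihedralPerm_succ {N : ℕ} (δ : DihedralGroup N) (i : ZMod N) :
    dihedralPerm N δ (i + 1) = dihedralPerm N δ i + 1 ∨
      dihedralPerm N δ (i + 1) + 1 = dihedralPerm N δ i := by
  have h := dihedralPerm_symm_succ N δ⁻¹ i
  rwa [map_inv] at h

theorem cyclicEdges_comp_dihedralPerm {V : Type*} {N : ℕ} (f : ZMod N → V) (δ : DihedralGroup N) :
    cyclicEdges (f ∘ dihedralPerm N δ) = cyclicEdges f := by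
  have key : ∀ (g : ZMod N → V) (δ : DihedralGroup N),
      cyclicEdges (g ∘ dihedralPerm N δ) ⊆ cyclicEdges g := by
    rintro g δ _ ⟨i, rfl⟩
    rcases dihedralPerm_succ δ i with h | h
    · exact ⟨dihedralPerm N δ i, by simp only [Function.comp_apply, h]⟩
    · exact ⟨dihedralPerm N δ (i + 1), by simp only [Function.comp_apply, h, Sym2.eq_swap]⟩
  refine (key f δ).antisymm ?_
  have h := key (f ∘ dihedralPerm N δ) δ⁻¹
  have hid : (f ∘ dihedralPerm N δ) ∘ dihedralPerm N δ⁻¹ = f := by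
    funext x
    rw [map_inv]
    exact congrArg f ((dihedralPerm N δ).apply_symm_apply x)
  rwa [hid] at h

/-- A permutation of `ZMod N` that takes neighbours to neighbours is a rotation or a reflection:
it can never change its direction, as it would run back to a point already visited. -/
theorem exists_dihedralPerm_eq {N : ℕ} (hN : 3 ≤ N) (h : Equiv.Perm (ZMod N))
    (hh : ∀ i, h (i + 1) = h i + 1 ∨ h i = h (i + 1) + 1) :
    ∃ δ : DihedralGroup N, dihedralPerm N δ = h := by
  have : NeZero N := ⟨by omega⟩
  have h2 : (2 : ZMod N) ≠ 0 := by
    intro h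
    have h' : ((2 : ℕ) : ZMod N) = 0 := by exact_mod_cast h
    rw [ZMod.natCast_eq_zero_iff] at h'
    exact absurd (Nat.le_of_dvd two_pos h') (by omega)
  have hne : ∀ i : ZMod N, h (i + 1 + 1) ≠ h i := by
    intro i hi
    refine h2 ?_
    have := h.injective hi
    linear_combination this
  -- the step `h (i + 1) - h i` does not depend on `i`
  have hstep : ∀ i, h (i + 1 + 1) - h (i + 1) = h (i + 1) - h i := by
    intro i
    rcases hh i with h1 | h1 <;> rcases hh (i + 1) with h3 | h3
    · linear_combination h3 - h1
    · exact absurd (add_right_cancel (h3.symm.trans h1)) (hne i)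
    · exact absurd (h3.trans h1.symm) (hne i)
    · linear_combination h1 - h3
  have hconst : ∀ m : ℕ, h ((m : ZMod N) + 1) - h m = h 1 - h 0 := by
    intro m
    induction m with
    | zero => rw [Nat.cast_zero, zero_add]
    | succ m ih => rw [Nat.cast_succ, hstep, ih]
  have hlin : ∀ m : ℕ, h m = h 0 + m * (h 1 - h 0) := by
    intro m
    induction m with
    | zero => rw [Nat.cast_zero, zero_mul, add_zero]
    | succ m ih =>
      have := hconst m
      push_cast
      linear_combination this + ih
  have hlin' : ∀ x : ZMod N, h x = h 0 + x * (h 1 - h 0) := by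
    intro x
    have := hlin x.val
    rwa [ZMod.natCast_zmod_val] at this
  have h0 := hh 0
  rw [zero_add] at h0
  rcases h0 with h0 | h0
  · refine ⟨DihedralGroup.r (h 0), Equiv.ext fun x => ?_⟩
    change x + h 0 = h x
    rw [hlin' x, h0]
    ring
  · refine ⟨DihedralGroup.sr (-h 0), Equiv.ext fun x => ?_⟩
    change -(-h 0) - x = h x
    rw [hlin' x, h0]
    ring

/-- The undirected cycle determines the cyclic ordering up to rotations and reflections. -/
theorem cyclicEdges_eq_iff {V : Type*} {N : ℕ} (hN : 3 ≤ N) (f g : ZMod N ≃ V) :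
    cyclicEdges f = cyclicEdges g ↔ ∃ δ : DihedralGroup N, ∀ i, f i = g (dihedralPerm N δ i) := by
  constructor
  · intro h
    have hstep : ∀ i, g.symm (f (i + 1)) = g.symm (f i) + 1 ∨
        g.symm (f i) = g.symm (f (i + 1)) + 1 := by
      intro i
      obtain ⟨j, hj⟩ : s(f i, f (i + 1)) ∈ cyclicEdges g := h ▸ ⟨i, rfl⟩
      rcases Sym2.eq_iff.1 hj with ⟨h1, h2⟩ | ⟨h1, h2⟩
      · left
        rw [← h1, ← h2, g.symm_apply_apply, g.symm_apply_apply]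
      · right
        rw [← h1, ← h2, g.symm_apply_apply, g.symm_apply_apply]
    obtain ⟨δ, hδ⟩ := exists_dihedralPerm_eq hN (f.trans g.symm) hstep
    refine ⟨δ, fun i => ?_⟩
    rw [hδ, Equiv.trans_apply, Equiv.apply_symm_apply]
  · rintro ⟨δ, hδ⟩
    rw [← cyclicEdges_comp_dihedralPerm g δ]
    exact congrArg cyclicEdges (funext hδ)

theorem image_cyclicEdges {V W : Type*} {N : ℕ} (f : ZMod N → V) (φ : V → W) :
    Sym2.map φ '' cyclicEdges f = cyclicEdges (φ ∘ f) := by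
  rw [cyclicEdges, ← Set.range_comp]
  rfl

/-! ### Cyclic orderings and diagrams -/

/-- The cyclic orderings of the vertices of `K_{d,…,d}` in which neighbours lie in different
parts. Each gives a loopless diagram, by forgetting all but the parts, and a Hamiltonian cycle, by
forgetting the starting point and the direction. -/
def CyclicOrdering (d n : ℕ) : Type :=
  {f : ZMod (d * n) ≃ Fin n × Fin d // ∀ i, (f i).1 ≠ (f (i + 1)).1}

/-- The diagram whose blocks are the parts of the graph. -/
def CyclicOrdering.toDiagram {d n : ℕ} (f : CyclicOrdering d n) : LooplessDiagram d n := by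
  refine ⟨Setoid.ker fun i => (f.1 i).1, fun x => ?_, fun x _ => f.2 x⟩
  have h : {y | Setoid.ker (fun i => (f.1 i).1) x y} =
      (fun j => f.1.symm ((f.1 x).1, j)) '' Set.univ := by
    ext y
    rw [Set.image_univ]
    constructor
    · intro hy
      refine ⟨(f.1 y).2, ?_⟩
      change f.1.symm ((f.1 x).1, (f.1 y).2) = y
      rw [Equiv.symm_apply_eq]
      exact Prod.ext hy rfl
    · rintro ⟨j, rfl⟩
      change (f.1 x).1 = (f.1 (f.1.symm ((f.1 x).1, j))).1
      rw [Equiv.apply_symm_apply]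
  rw [h, Set.ncard_image_of_injective, Set.ncard_univ, Nat.card_fin]
  intro i j hij
  exact (Prod.ext_iff.1 (f.1.symm.injective hij)).2

theorem CyclicOrdering.toDiagram_rel {d n : ℕ} (f : CyclicOrdering d n) (x y : ZMod (d * n)) :
    f.toDiagram.1 x y ↔ (f.1 x).1 = (f.1 y).1 := Iff.rfl

/-- The blocks of a diagram can be identified with the parts of the graph: there are `n` of them,
and each has `d` elements. -/
theorem CyclicOrdering.toDiagram_surjective {d n : ℕ} (hN : 3 ≤ d * n) :
    Function.Surjective (CyclicOrdering.toDiagram (d := d) (n := n)) := by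
  intro D
  have : NeZero (d * n) := ⟨by omega⟩
  have hd : 0 < d := Nat.pos_of_mul_pos_right (show 0 < d * n by omega)
  have hfib : ∀ q : Quotient D.1, Nat.card {x // Quotient.mk D.1 x = q} = Nat.card (Fin d) := by
    intro q
    induction q using Quotient.inductionOn with | _ x => ?_
    refine (Nat.card_congr (Equiv.subtypeEquivRight fun y =>
      Quotient.eq.trans ⟨D.1.symm, D.1.symm⟩)).trans ((D.2.1 x).trans (Nat.card_fin d).symm)
  let e : ∀ q : Quotient D.1, {x // Quotient.mk D.1 x = q} ≃ Fin d :=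
    fun q => (Finite.card_eq.1 (hfib q)).some
  let E : ZMod (d * n) ≃ Quotient D.1 × Fin d :=
    (Equiv.sigmaFiberEquiv (Quotient.mk D.1)).symm.trans
      ((Equiv.sigmaCongrRight e).trans (Equiv.sigmaEquivProd _ _))
  have hQ : Nat.card (Quotient D.1) = Nat.card (Fin n) := by
    have h : Nat.card (Quotient D.1) * d = n * d := by
      calc Nat.card (Quotient D.1) * d = Nat.card (Quotient D.1 × Fin d) := by
            rw [Nat.card_prod, Nat.card_fin]
        _ = Nat.card (ZMod (d * n)) := (Nat.card_congr E).symm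
        _ = n * d := by rw [Nat.card_zmod, mul_comm]
    rw [Nat.card_fin]
    exact Nat.eq_of_mul_eq_mul_right hd h
  let c : Quotient D.1 ≃ Fin n := (Finite.card_eq.1 hQ).some
  have hE : ∀ x y, ((E.trans (c.prodCongr (Equiv.refl _))) x).1 =
      ((E.trans (c.prodCongr (Equiv.refl _))) y).1 ↔ D.1 x y := by
    intro x y
    exact c.injective.eq_iff.trans Quotient.eq
  refine ⟨⟨E.trans (c.prodCongr (Equiv.refl _)), fun i => ?_⟩, ?_⟩
  · rw [Ne, hE]
    refine D.2.2 i fun h => ?_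
    have h1 : ((1 : ℕ) : ZMod (d * n)) = 0 := by
      rw [Nat.cast_one]
      linear_combination -h
    rw [ZMod.natCast_eq_zero_iff] at h1
    exact absurd (Nat.le_of_dvd one_pos h1) (by omega)
  · exact Subtype.ext (Setoid.ext hE)

/-- The Hamiltonian cycle that passes through the vertices in the given order. -/
def CyclicOrdering.toHamCycle {d n : ℕ} (hN : 3 ≤ d * n) (f : CyclicOrdering d n) :
    HamCycle (SimpleGraph.completeEquipartiteGraph n d) :=
  ⟨cyclicEdges f.1, exists_isHamiltonianCycle hN f.1 f.2⟩

theorem CyclicOrdering.toHamCycle_surjective {d n : ℕ} (hN : 3 ≤ d * n) :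
    Function.Surjective (CyclicOrdering.toHamCycle (d := d) (n := n) hN) := by
  rintro ⟨E, u, p, hp, rfl⟩
  have : NeZero (d * n) := ⟨by omega⟩
  obtain ⟨f, hf, h⟩ := exists_cyclic_ordering (N := d * n)
    (by rw [Fintype.card_prod, Fintype.card_fin, Fintype.card_fin, mul_comm]) hp
  exact ⟨⟨f, hf⟩, Subtype.ext h.symm⟩

/-- Two cyclic orderings give the same diagram up to the dihedral group if and only if they give
the same Hamiltonian cycle up to automorphisms: both mean that the orderings differ by a dihedral
permutation of the positions and a permutation of the vertices that preserves the parts. -/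
theorem CyclicOrdering.orbitRel_iff {d n : ℕ} (hN : 3 ≤ d * n) (f g : CyclicOrdering d n) :
    MulAction.orbitRel (DihedralGroup (d * n)) (LooplessDiagram d n) f.toDiagram g.toDiagram ↔
      hamCycleSetoid _ (f.toHamCycle hN) (g.toHamCycle hN) := by
  have himg : ∀ φ : SimpleGraph.completeEquipartiteGraph n d ≃g
      SimpleGraph.completeEquipartiteGraph n d,
      Sym2.map φ '' (f.toHamCycle hN).1 = (g.toHamCycle hN).1 ↔
        ∃ δ : DihedralGroup (d * n), ∀ i, φ (f.1 i) = g.1 (dihedralPerm _ δ i) := fun φ => by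
    refine Iff.trans ?_ (cyclicEdges_eq_iff hN (f.1.trans φ.toEquiv) g.1)
    change Sym2.map φ '' cyclicEdges f.1 = cyclicEdges g.1 ↔ _
    rw [image_cyclicEdges]
    rfl
  have hsmul : ∀ (δ : DihedralGroup (d * n)) (x y), (δ⁻¹ • g.toDiagram).1 x y ↔
      (g.1 (dihedralPerm _ δ x)).1 = (g.1 (dihedralPerm _ δ y)).1 := fun δ x y => by
    change permSetoid (dihedralPerm _ δ⁻¹) g.toDiagram.1 x y ↔ _
    rw [map_inv]
    rfl
  constructor
  · rintro ⟨δ, hδ⟩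
    have hrel : ∀ x y, (g.1 (dihedralPerm _ δ⁻¹ x)).1 = (g.1 (dihedralPerm _ δ⁻¹ y)).1 ↔
        (f.1 x).1 = (f.1 y).1 := fun x y => by
      rw [← hsmul, inv_inv, ← f.toDiagram_rel, ← hδ]
    let φ : SimpleGraph.completeEquipartiteGraph n d ≃g
        SimpleGraph.completeEquipartiteGraph n d :=
      { toEquiv := f.1.symm.trans ((dihedralPerm _ δ⁻¹).trans g.1)
        map_rel_iff' := fun {a b} => by
          rw [SimpleGraph.completeEquipartiteGraph_adj, SimpleGraph.completeEquipartiteGraph_adj]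
          refine not_congr ((hrel _ _).trans ?_)
          rw [f.1.apply_symm_apply, f.1.apply_symm_apply] }
    refine ⟨φ, (himg φ).2 ⟨δ⁻¹, fun i => ?_⟩⟩
    exact congrArg (fun x => g.1 (dihedralPerm _ δ⁻¹ x)) (f.1.symm_apply_apply i)
  · rintro ⟨φ, hφ⟩
    obtain ⟨δ, hδ⟩ := (himg φ).1 hφ
    refine ⟨δ⁻¹, Subtype.ext (Setoid.ext fun x y => (hsmul δ x y).trans ?_)⟩
    rw [← hδ, ← hδ, f.toDiagram_rel]
    exact not_iff_not.1 φ.map_rel_iff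

theorem card_quotient_comap {α β : Type*} (r : Setoid β) {a : α → β}
    (ha : Function.Surjective a) :
    Nat.card (Quotient (Setoid.comap a r)) = Nat.card (Quotient r) := by
  rw [Nat.card_congr (Setoid.comapQuotientEquiv a r),
    (Quotient.mk''_surjective.comp ha).range_eq, Nat.card_congr (Equiv.Set.univ _)]

theorem card_quotient_eq_of_surjective {α β γ : Type*} {r : Setoid β} {r' : Setoid γ}
    {a : α → β} {b : α → γ} (ha : Function.Surjective a) (hb : Function.Surjective b)
    (h : ∀ x y, r (a x) (a y) ↔ r' (b x) (b y)) :
    Nat.card (Quotient r) = Nat.card (Quotient r') := by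
  have hcomap : Setoid.comap a r = Setoid.comap b r' := Setoid.ext h
  rw [← card_quotient_comap r ha, hcomap, card_quotient_comap r' hb]

theorem numUnlabelled_eq_numHamCycles {d n : ℕ} (hN : 3 ≤ d * n) :
    numUnlabelled d n = numHamCycles (SimpleGraph.completeEquipartiteGraph n d) :=
  card_quotient_eq_of_surjective (CyclicOrdering.toDiagram_surjective hN)
    (CyclicOrdering.toHamCycle_surjective hN) (CyclicOrdering.orbitRel_iff hN)

end KChord

theorem mainTheorem8 (d n : ℕ) (hd : 1 ≤ d) (hn : 1 ≤ n) :
    -- `f(dn, m)` counts the diagrams fixed by any rotation of order `m`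
    (∀ i : ZMod (d * n), KChord.numFixed d n (DihedralGroup.r i) =
      KChord.rotSym d n (orderOf (DihedralGroup.r i))) ∧
    -- `h^{(i)}(n)` counts the diagrams fixed by any reflection whose axis passes through `i` points
    (∀ a : ZMod (d * n), KChord.numFixed d n (DihedralGroup.sr a) =
      KChord.reflSym d n (KChord.axisPoints (d * n) a)) ∧
    -- the number of diagrams up to rotations and reflections
    ((KChord.numUnlabelled d n : ℚ) =
      1 / (2 * d * n) *
          ∑ m ∈ (d * n).divisors, (Nat.totient m : ℚ) * (KChord.rotSym d n m : ℚ) +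
        ((KChord.reflSym d n 0 : ℚ) + 2 * KChord.reflSym d n 1 + KChord.reflSym d n 2) / 4) ∧
    -- the numbers `h^{(i)}(n)` that vanish for parity reasons
    (Odd (d * n) → KChord.reflSym d n 0 = 0 ∧ KChord.reflSym d n 2 = 0) ∧
    (Even (d * n) → KChord.reflSym d n 1 = 0) ∧
    -- `d` even
    (2 ≤ n → Even d →
      (KChord.reflSym d n 0 : ℤ) =
          KChord.numLinear 2 d (d * n / 2) 0
          - 2 * ∑ k ∈ Finset.range (d / 2),
              KChord.alpha1 d n k * KChord.numLinear 2 d (d * (n - 1) / 2) k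
          + ∑ k ∈ Finset.range (d - 1),
              KChord.alpha2 d n k * KChord.numLinear 2 d (d * (n - 2) / 2) k
          - ∑ k ∈ Finset.range (d / 2 - 1),
              KChord.alpha3 d n k * KChord.numLinear 2 d (d * (n - 1) / 2) k ∧
      (KChord.reflSym d n 2 : ℤ) =
          ∑ k ∈ Finset.range (d / 2),
            KChord.alpha1 d n k * KChord.numLinear 2 d (d * (n - 1) / 2) k) ∧
    -- `d` odd, `n` even
    (2 ≤ n → Odd d → Even n →
      KChord.reflSym d n 0 = KChord.numLinear 2 d (d * n / 2) 0 ∧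
      (KChord.reflSym d n 2 : ℤ) =
          ∑ k ∈ Finset.range d, ∑ j ∈ Finset.range ((d - 1) / 2 + 1),
            ∑ s ∈ Finset.range (min k ((d - 1) / 2 - j) + 1),
              KChord.binom ((d - 1) / 2 : ℕ) j * KChord.binom k s *
                KChord.binom ((d * (n - 2) / 2 : ℕ) - k) (((d - 1) / 2 : ℕ) - j - s) *
                KChord.binom (((d * (n - 1) - 1) / 2 : ℕ) - (k + j - s))
                  (((d - 1) / 2 : ℕ) - (k + j - s)) *
                KChord.numLinear 2 d (d * (n - 2) / 2) k) ∧
    -- `d` odd, `n` odd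
    (2 ≤ n → Odd d → Odd n →
      (KChord.reflSym d n 1 : ℤ) =
          ∑ k ∈ Finset.range ((d - 1) / 2 + 1),
            KChord.binom ((d * (n - 1) / 2 : ℕ) - 1 - k) (((d - 1) / 2 : ℕ) - k) *
              KChord.numLinear 2 d (d * (n - 1) / 2) k) ∧
    -- undirected unlabelled Hamiltonian cycles in `K_{d,…,d}` with `n` parts
    (3 ≤ d * n → KChord.numUnlabelled d n =
      KChord.numHamCycles (SimpleGraph.completeEquipartiteGraph n d)) := by
  have : NeZero (d * n) := ⟨(Nat.mul_pos hd hn).ne'⟩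
  exact ⟨KChord.numFixed_r, KChord.numFixed_sr_eq_reflSym, KChord.numUnlabelled_eq hd hn,
    fun h => ⟨KChord.reflSym_of_odd h zero_ne_one, KChord.reflSym_of_odd h (by norm_num)⟩,
    KChord.reflSym_one_of_even, KChord.reflSym_formula_even hd,
    KChord.reflSym_formula_odd_even, KChord.reflSym_formula_odd_odd,
    KChord.numUnlabelled_eq_numHamCycles⟩
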